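/- Let $n\ge 1$. Let $W(B_n)=\{\pm1\}^n\rtimes S_n$ be the group of signed permutations acting on $E=\mathbb R^n$, and let $W(D_n)\subset W(B_n)$ be the subgroup of signed permutations with an even number of minus signs. Let $R(W(D_n))$ be the Grothendieck group of finite-dimensional complex representations of $W(D_n)$, with the elliptic pairing $$\langle\sigma,\sigma'\rangle^{\mathrm{ell}}=\frac1{|W(D_n)|}\sum_{w\in W(D_n)}\sigma(w)\,\sigma'(w)\,\det{}_E(1-w),$$ where $\sigma(w)$, $\sigma'(w)$ denote character values, and let $\overline R(W(D_n))$ be the quotient of $R(W(D_n))$ by the radical of this pairing, with the induced pairing. For a partition $\lambda$ of $n$ let $\sigma_\lambda$ be the corresponding irreducible representation of $S_n$ (with $\sigma_{(n)}$ trivial), let $\lambda\times\emptyset$ be the representation of $W(D_n)$ obtained by pulling $\sigma_\lambda$ back along $W(D_n)\subset W(B_n)\to S_n$, and let $[\lambda\times\emptyset]$ be its class in $\overline R(W(D_n))$. Let $\lambda^t$ be the transpose of $\lambda$, and let $\overline P(n)$ be a set of representatives (chosen arbitrarily) for the partitions of $n$ under the relation $\lambda\cong\lambda^t$. (1) If $n$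 is odd, then the classes $[\lambda\times\emptyset]$, for $\lambda\in\overline P(n)$ with $\lambda\ne\lambda^t$, form an orthonormal $\mathbb Z$-basis of $\overline R(W(D_n))$ with respect to the elliptic pairing. (2) If $n$ is even, then the classes $[\lambda\times\emptyset]$, for $\lambda\in\overline P(n)$, form an orthogonal $\mathbb Z$-basis of $\overline R(W(D_n))$, and $$\langle\lambda\times\emptyset,\lambda\times\emptyset\rangle^{\mathrm{ell}}_{W(D_n)}=\begin{cases}1,&\lambda\neq\lambda^t,\\ 2,&\lambda=\lambda^t.\end{cases}$$ -/

import Mathlib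

/-! ### The Grothendieck group and the elliptic quotient of a finite group -/

noncomputable section Elliptic

/-- The trace is additive on short exact sequences. -/
theorem trace_of_exact {U V Q : Type*} [AddCommGroup U] [Module ℂ U] [FiniteDimensional ℂ U]
    [AddCommGroup V] [Module ℂ V] [FiniteDimensional ℂ V]
    [AddCommGroup Q] [Module ℂ Q] [FiniteDimensional ℂ Q]
    (f : U →ₗ[ℂ] V) (g : V →ₗ[ℂ] Q) (hf : Function.Injective f) (hfg : Function.Exact f g)
    (hg : Function.Surjective g) (a : U →ₗ[ℂ] U) (b : V →ₗ[ℂ] V) (c : Q →ₗ[ℂ] Q)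
    (hab : f ∘ₗ a = b ∘ₗ f) (hbc : g ∘ₗ b = c ∘ₗ g) :
    LinearMap.trace ℂ V b = LinearMap.trace ℂ U a + LinearMap.trace ℂ Q c := by
  obtain ⟨l, hl⟩ := g.exists_rightInverse_of_surjective (LinearMap.range_eq_top.2 hg)
  obtain ⟨e, he1, he2⟩ := hfg.splitSurjectiveEquiv hf ⟨l, hl⟩
  have hf' : e.toLinearMap ∘ₗ f = LinearMap.inl ℂ U Q := by
    rw [he1]; ext x <;> simp
  have hg' : g ∘ₗ e.symm.toLinearMap = LinearMap.snd ℂ U Q := by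
    rw [he2]; ext x <;> simp
  set ψ := e.conj b with hψ
  have h1 : ψ ∘ₗ LinearMap.inl ℂ U Q = LinearMap.inl ℂ U Q ∘ₗ a := by
    rw [← hf', LinearMap.comp_assoc, hab]
    apply LinearMap.ext; intro x
    simp only [hψ, LinearEquiv.conj_apply, LinearMap.comp_apply, LinearEquiv.coe_coe,
      LinearEquiv.symm_apply_apply]
  have h2 : LinearMap.snd ℂ U Q ∘ₗ ψ = c ∘ₗ LinearMap.snd ℂ U Q := by
    rw [← hg', ← LinearMap.comp_assoc, ← hbc]
    apply LinearMap.ext; intro x; simp [hψ, LinearEquiv.conj_apply]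
  have hid : ψ = (ψ ∘ₗ LinearMap.inl ℂ U Q) ∘ₗ LinearMap.fst ℂ U Q +
      (ψ ∘ₗ LinearMap.inr ℂ U Q) ∘ₗ LinearMap.snd ℂ U Q := by
    apply LinearMap.ext
    rintro ⟨x, y⟩
    simp [← map_add]
  have ht : LinearMap.trace ℂ V b = LinearMap.trace ℂ _ ψ := (LinearMap.trace_conj' b e).symm
  rw [ht, hid, map_add, LinearMap.trace_comp_comm',
    LinearMap.trace_comp_comm' (LinearMap.snd ℂ U Q), h1, ← LinearMap.comp_assoc, ← LinearMap.comp_assoc,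
    LinearMap.fst_comp_inl, h2, LinearMap.comp_assoc, LinearMap.snd_comp_inr]
  simp

/-- The relations of the Grothendieck group: `[V] = [U] + [Q]` for every short exact sequence
`0 → U → V → Q → 0` of finite-dimensional complex representations of `G`. -/
def grothendieckRelations (G : Type) [Group G] : AddSubgroup (FreeAbelianGroup (FDRep ℂ G)) :=
  AddSubgroup.closure
    {x | ∃ (U V Q : FDRep ℂ G) (f : U →ₗ[ℂ] V) (g : V →ₗ[ℂ] Q),
      (∀ w : G, f ∘ₗ U.ρ w = V.ρ w ∘ₗ f) ∧ (∀ w : G, g ∘ₗ V.ρ w = Q.ρ w ∘ₗ g) ∧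
      Function.Injective f ∧ Function.Exact f g ∧ Function.Surjective g ∧
      x = FreeAbelianGroup.of V - FreeAbelianGroup.of U - FreeAbelianGroup.of Q}

/-- `R(G)`: the Grothendieck group of finite-dimensional complex representations of `G`. -/
abbrev RepGroup (G : Type) [Group G] : Type 1 :=
  FreeAbelianGroup (FDRep ℂ G) ⧸ grothendieckRelations G

/-- The class in `R(G)` of a representation. -/
def RepGroup.mk {G : Type} [Group G] (V : FDRep ℂ G) : RepGroup G :=
  QuotientAddGroup.mk (FreeAbelianGroup.of V)

/-- The character of a virtual representation. -/
def RepGroup.character (G : Type) [Group G] : RepGroup G →+ (G → ℂ) :=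
  QuotientAddGroup.lift (grothendieckRelations G)
    (FreeAbelianGroup.lift fun V : FDRep ℂ G => V.character) (by
      rw [grothendieckRelations, AddSubgroup.closure_le]
      rintro x ⟨U, V, Q, f, g, hf, hg, hinj, hex, hsurj, rfl⟩
      rw [SetLike.mem_coe, AddMonoidHom.mem_ker, map_sub, map_sub, FreeAbelianGroup.lift_apply_of,
        FreeAbelianGroup.lift_apply_of, FreeAbelianGroup.lift_apply_of]
      funext w
      have := trace_of_exact f g hinj hex hsurj _ _ _ (hf w) (hg w)
      simp only [Pi.sub_apply, Pi.zero_apply, FDRep.character]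
      rw [this]
      ring)

section Pairing

variable {G : Type} [Group G] [Fintype G] {E : Type} [AddCommGroup E] [Module ℝ E]

/-- The elliptic pairing on `R(G)` attached to a real representation `r` of `G` on `E`:
`⟨σ, σ'⟩ = |G|⁻¹ ∑ w, σ(w) σ'(w) det_E(1 - w)`. -/
def ellipticPairing (r : Representation ℝ G E) : RepGroup G →+ RepGroup G →+ ℂ :=
  AddMonoidHom.mk'
    (fun x => AddMonoidHom.mk'
      (fun y => (Fintype.card G : ℂ)⁻¹ * ∑ w : G, RepGroup.character G x w *
        RepGroup.character G y w * ((LinearMap.det (1 - r w) : ℝ) : ℂ))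
      (fun y z => by
        simp only [map_add, Pi.add_apply, mul_add, add_mul, Finset.sum_add_distrib]))
    (fun x y => by
      refine AddMonoidHom.ext fun z => ?_
      simp only [AddMonoidHom.mk'_apply, AddMonoidHom.add_apply, map_add, Pi.add_apply, mul_add,
        add_mul, Finset.sum_add_distrib])

theorem ellipticPairing_comm (r : Representation ℝ G E) (x y : RepGroup G) :
    ellipticPairing r x y = ellipticPairing r y x := by
  simp only [ellipticPairing, AddMonoidHom.mk'_apply]
  congr 1
  exact Finset.sum_congr rfl fun w _ => by ring

/-- The radical of the (symmetric) elliptic pairing. -/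
def ellipticRadical (r : Representation ℝ G E) : AddSubgroup (RepGroup G) :=
  (ellipticPairing r).ker

/-- The quotient of `R(G)` by the radical of the elliptic pairing. -/
abbrev EllipticRepGroup (r : Representation ℝ G E) : Type 1 :=
  RepGroup G ⧸ ellipticRadical r

/-- The class of a representation in the elliptic quotient. -/
def EllipticRepGroup.mk (r : Representation ℝ G E) (V : FDRep ℂ G) : EllipticRepGroup r :=
  QuotientAddGroup.mk (RepGroup.mk V)

/-- The form induced by the elliptic pairing on the elliptic quotient. -/
def EllipticRepGroup.pairing (r : Representation ℝ G E) :
    EllipticRepGroup r →+ EllipticRepGroup r →+ ℂ :=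
  QuotientAddGroup.lift (ellipticRadical r)
    (AddMonoidHom.mk'
      (fun x => QuotientAddGroup.lift (ellipticRadical r) (ellipticPairing r x) (by
        intro y hy
        have hy' : ellipticPairing r y = 0 := hy
        rw [AddMonoidHom.mem_ker, ellipticPairing_comm, hy', AddMonoidHom.zero_apply]))
      (fun x y => by
        ext z
        simp))
    (by
      intro x hx
      have hx' : ellipticPairing r x = 0 := hx
      rw [AddMonoidHom.mem_ker]
      ext z
      simp [hx'])

end Pairing

end Elliptic

/-! ### Partitions and the irreducible representations of the symmetric group -/

noncomputable section Symmetric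

/-- Partitions of `n`, as Young diagrams with `n` cells; the cell `(i, j)` is in row `i` and
column `j`. -/
abbrev Ptn (n : ℕ) : Type := {μ : YoungDiagram // μ.card = n}

/-- The transposed partition. -/
def Ptn.transpose {n : ℕ} (μ : Ptn n) : Ptn n :=
  ⟨μ.1.transpose, by
    simpa [YoungDiagram.card, YoungDiagram.transpose] using μ.2⟩

/-- Two partitions are identified if they are equal or transposed to each other. -/
def Ptn.setoid (n : ℕ) : Setoid (Ptn n) where
  r μ ν := ν = μ ∨ ν = μ.transpose
  iseqv := by
    have ht : ∀ μ : Ptn n, μ.transpose.transpose = μ := fun μ =>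
      Subtype.ext (YoungDiagram.transpose_transpose μ.1)
    refine ⟨fun _ => Or.inl rfl, ?_, ?_⟩
    · rintro μ ν (rfl | rfl)
      · exact Or.inl rfl
      · exact Or.inr (ht μ).symm
    · rintro μ ν κ (rfl | rfl) (rfl | rfl)
      · exact Or.inl rfl
      · exact Or.inr rfl
      · exact Or.inr rfl
      · exact Or.inl (ht μ)

/-- Partitions of `n` up to transposition. -/
abbrev PtnClass (n : ℕ) : Type := Quotient (Ptn.setoid n)

/-- A bijective filling of the cells of `μ` by `0, …, n - 1`: `k` is placed in the cell
`μ.tableau k`. -/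
def Ptn.tableau {n : ℕ} (μ : Ptn n) : Fin n ≃ μ.1.cells :=
  (Finset.equivFinOfCardEq μ.2).symm

open Classical in
/-- The Young symmetrizer `(∑ p) * (∑ sgn(q) q)`, where `p` runs over the permutations preserving
each row of the tableau and `q` over those preserving each column. -/
def Ptn.symmetrizer {n : ℕ} (μ : Ptn n) : MonoidAlgebra ℂ (Equiv.Perm (Fin n)) :=
  (∑ p : Equiv.Perm (Fin n) with ∀ k, (μ.tableau (p k)).1.1 = (μ.tableau k).1.1,
      MonoidAlgebra.single p (1 : ℂ)) *
    ∑ q : Equiv.Perm (Fin n) with ∀ k, (μ.tableau (q k)).1.2 = (μ.tableau k).1.2,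
      MonoidAlgebra.single q (((Equiv.Perm.sign q : ℤˣ) : ℤ) : ℂ)

/-- The left ideal of `ℂ[S_n]` generated by the Young symmetrizer. -/
def Ptn.specht {n : ℕ} (μ : Ptn n) : Submodule ℂ (MonoidAlgebra ℂ (Equiv.Perm (Fin n))) :=
  LinearMap.range (LinearMap.mulRight ℂ μ.symmetrizer)

/-- The irreducible representation `σ_μ` of `S_n`, acting by left multiplication on the left ideal
generated by the Young symmetrizer. For `μ = (n)` it is the trivial representation. -/
def Ptn.rep {n : ℕ} (μ : Ptn n) : Representation ℂ (Equiv.Perm (Fin n)) μ.specht where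
  toFun g := (LinearMap.mulLeft ℂ (MonoidAlgebra.single g (1 : ℂ))).restrict (by
    rintro _ ⟨x, rfl⟩
    exact ⟨MonoidAlgebra.single g (1 : ℂ) * x, by simp [mul_assoc]⟩)
  map_one' := by
    ext x
    simp [← MonoidAlgebra.one_def]
  map_mul' g h := by
    apply LinearMap.ext
    intro x
    apply Subtype.ext
    simp [← mul_assoc, MonoidAlgebra.single_mul_single]

end Symmetric

/-! ### The Weyl groups of type `B_n` and `D_n` -/

noncomputable section Weyl

/-- `W(B_n)`: signed permutations, as the semidirect product of the sign changes by `S_n`, which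
permutes the coordinates. -/
abbrev WB (n : ℕ) : Type :=
  (Fin n → ℤˣ) ⋊[mulAutArrow (G := Equiv.Perm (Fin n)) (A := Fin n) (M := ℤˣ)]
    Equiv.Perm (Fin n)

/-- The product of the signs of a signed permutation. -/
def signProd (n : ℕ) : WB n →* ℤˣ where
  toFun w := ∏ i, w.left i
  map_one' := by simp
  map_mul' v w := by
    simp only [SemidirectProduct.mul_left, Pi.mul_apply, Finset.prod_mul_distrib]
    congr 1
    exact Equiv.prod_comp (v.right⁻¹) w.left

/-- `W(D_n)`: the signed permutations with an even number of minus signs. -/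
def WD (n : ℕ) : Subgroup (WB n) := (signProd n).ker

instance instFintypeWB (n : ℕ) : Fintype (WB n) :=
  Fintype.ofEquiv _ SemidirectProduct.equivProd.symm

instance instFintypeWD (n : ℕ) : Fintype (WD n) := Fintype.ofFinite _

/-- The reflection representation of `W(B_n)` on `ℝⁿ`: the signed permutation `(ε, π)` sends the
basis vector `e_j` to `ε_{π j} e_{π j}`. -/
def reflB (n : ℕ) : Representation ℝ (WB n) (Fin n → ℝ) where
  toFun w :=
    { toFun := fun v i => ((w.left i : ℤ) : ℝ) * v (w.right⁻¹ i)
      map_add' := fun u v => by funext i; simp [mul_add]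
      map_smul' := fun a v => by funext i; simp [mul_left_comm] }
  map_one' := by
    apply LinearMap.ext; intro v; funext i; simp
  map_mul' u w := by
    apply LinearMap.ext; intro v; funext i
    simp [mul_assoc]
    exact Or.inl rfl

/-- The reflection representation of `W(D_n)` on `ℝⁿ`. -/
def reflD (n : ℕ) : Representation ℝ (WD n) (Fin n → ℝ) := (reflB n).comp (WD n).subtype

/-- The representation `μ × ∅` of `W(B_n)`: the pullback of `σ_μ` along `W(B_n) → S_n`. -/
def Ptn.repB {n : ℕ} (μ : Ptn n) : Representation ℂ (WB n) μ.specht :=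
  μ.rep.comp SemidirectProduct.rightHom

/-- The restriction of `μ × ∅` to `W(D_n)`. -/
def Ptn.repD {n : ℕ} (μ : Ptn n) : FDRep ℂ (WD n) :=
  FDRep.of (V := μ.specht) (μ.repB.comp (WD n).subtype)

/-- The elliptic quotient of the Grothendieck group of `W(D_n)`. -/
abbrev RbarD (n : ℕ) : Type 1 := EllipticRepGroup (reflD n)

/-- The class `[μ × ∅]` in the elliptic quotient for `W(D_n)`. -/
def Ptn.classD {n : ℕ} (μ : Ptn n) : RbarD n := EllipticRepGroup.mk (reflD n) μ.repD

end Weyl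

/-! The determinant is multilinear in rows. Hence, over the sign changes above a fixed permutation
p, det(1 - w) sums to 2^n, and to (-2)^n sgn(p) when weighted by the product of the signs. On W(D_n)
the elliptic pairing of representations pulled back from S_n therefore becomes the ordinary pairing
on S_n against 1 + (-1)^n sgn. Since sgn ⊗ σ_μ is σ_{μ^t}, orthonormality of irreducible characters
gives ⟨μ × ∅, ν × ∅⟩ = δ_{μ,ν} + (-1)^n δ_{μ^t,ν} (`Ptn.ellipticPairing_repD_repD`), hence all the
norms and orthogonality relations. The facts about S_n come from Young symmetrizers.

The classes detect zero because the pairing only sees elliptic elements, those with det(1 - w) ≠ 0.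
Such a w has product of signs -1 along every cycle, and two of them over the same permutation are
conjugate in W(D_n) (`WD.isConj_of_elliptic`). If a class function is orthogonal to every μ × ∅, its
product with det(1 - w) pushes forward to a class function on S_n orthogonal to all irreducible
characters. The pushforward is thus zero, and the original function vanishes on elliptic elements.

For a ℤ-basis, the coefficients ⟨x, b⟩ / ⟨b, b⟩ must be integers. Expanding det(1 - w) in principal
minors turns ⟨V, μ × ∅⟩ into an alternating sum of dimensions of invariants of stabilizers of
coordinate subspaces, so it is an integer. When n is even and μ = μ^t the norm is 2 and the pairing
must be even. The terms for k and n - k then agree, and the middle one is even because exchanging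
the two halves of the coordinates, combined with an intertwiner from σ_μ to sgn ⊗ σ_μ, acts on the
invariants with trace zero and nonzero scalar square (`exists_nat_minorSum_even`). -/

/-! ### Row and column sums in the group algebra -/

noncomputable section Symmetrizers

variable {n : ℕ}

open Classical in
/-- The sum of the permutations preserving the fibres of `f`. -/
def rowSum (f : Fin n → ℕ) : MonoidAlgebra ℂ (Equiv.Perm (Fin n)) :=
  ∑ p : Equiv.Perm (Fin n) with ∀ k, f (p k) = f k, MonoidAlgebra.single p (1 : ℂ)

open Classical in
/-- The signed sum of the permutations preserving the fibres of `f`. -/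
def colSum (f : Fin n → ℕ) : MonoidAlgebra ℂ (Equiv.Perm (Fin n)) :=
  ∑ q : Equiv.Perm (Fin n) with ∀ k, f (q k) = f k,
    MonoidAlgebra.single q (((Equiv.Perm.sign q : ℤˣ) : ℤ) : ℂ)

theorem rowSum_mul_single (f : Fin n → ℕ) {p : Equiv.Perm (Fin n)} (hp : ∀ k, f (p k) = f k) :
    rowSum f * MonoidAlgebra.single p 1 = rowSum f := by
  classical
  simp only [rowSum, Finset.sum_mul, MonoidAlgebra.single_mul_single, mul_one]
  refine Finset.sum_bij' (fun g _ => g * p) (fun g _ => g * p⁻¹) ?_ ?_ ?_ ?_ ?_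
  · simp +contextual [hp]
  · intro g hg
    simp only [Finset.mem_filter, Finset.mem_univ, true_and] at hg ⊢
    intro k
    simpa [hg] using (hp (p⁻¹ k)).symm
  · simp
  · simp
  · simp

theorem single_mul_colSum (f : Fin n → ℕ) {q : Equiv.Perm (Fin n)} (hq : ∀ k, f (q k) = f k) :
    MonoidAlgebra.single q 1 * colSum f = (((Equiv.Perm.sign q : ℤˣ) : ℤ) : ℂ) • colSum f := by
  classical
  simp only [colSum, Finset.mul_sum, MonoidAlgebra.single_mul_single, one_mul, Finset.smul_sum,
    MonoidAlgebra.smul_single, smul_eq_mul]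
  refine Finset.sum_bij' (fun g _ => q * g) (fun g _ => q⁻¹ * g) ?_ ?_ ?_ ?_ ?_
  · simp +contextual [hq]
  · intro g hg
    simp only [Finset.mem_filter, Finset.mem_univ, true_and] at hg ⊢
    intro k
    simpa [hg] using (hq (q⁻¹ (g k))).symm
  · simp
  · simp
  · intro g _
    rw [map_mul, ← Int.cast_mul, ← Units.val_mul, ← mul_assoc, Int.units_mul_self, one_mul]

/-- Conjugation by `x` carries the stabilizer of the fibres of `f` to that of `f ∘ x⁻¹` and
preserves signs. Moving group elements past column sums thus amounts to changing the filling. -/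
theorem single_mul_colSum_comm (f : Fin n → ℕ) (x : Equiv.Perm (Fin n)) :
    MonoidAlgebra.single x 1 * colSum f = colSum (f ∘ ⇑x⁻¹) * MonoidAlgebra.single x 1 := by
  classical
  simp only [colSum, Finset.mul_sum, Finset.sum_mul, MonoidAlgebra.single_mul_single, one_mul,
    mul_one]
  refine Finset.sum_bij' (fun g _ => x * g * x⁻¹) (fun g _ => x⁻¹ * g * x) ?_ ?_ ?_ ?_ ?_
  · simp +contextual
  · intro g hg
    simp only [Finset.mem_filter, Finset.mem_univ, true_and, Function.comp_apply] at hg ⊢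
    intro k
    simpa using hg (x k)
  · simp [mul_assoc]
  · simp [mul_assoc]
  · intro g _
    have : Equiv.Perm.sign (x * g * x⁻¹) = Equiv.Perm.sign g := by
      rw [map_mul, map_mul, mul_right_comm, ← map_mul, mul_inv_cancel, map_one, one_mul]
    simp [this]

theorem single_mul_rowSum_comm (f : Fin n → ℕ) (x : Equiv.Perm (Fin n)) :
    MonoidAlgebra.single x 1 * rowSum f = rowSum (f ∘ ⇑x⁻¹) * MonoidAlgebra.single x 1 := by
  classical
  simp only [rowSum, Finset.mul_sum, Finset.sum_mul, MonoidAlgebra.single_mul_single,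
    mul_one]
  refine Finset.sum_bij' (fun g _ => x * g * x⁻¹) (fun g _ => x⁻¹ * g * x) ?_ ?_ ?_ ?_ ?_
  · simp +contextual
  · intro g hg
    simp only [Finset.mem_filter, Finset.mem_univ, true_and, Function.comp_apply] at hg ⊢
    intro k
    simpa using hg (x k)
  · simp [mul_assoc]
  · simp [mul_assoc]
  · intro g _
    simp

/-- Two entries in a common row of one filling and a common column of another one make the
product of the row sum and the column sum vanish. -/
theorem rowSum_mul_colSum_eq_zero (f h : Fin n → ℕ) {k l : Fin n} (hkl : k ≠ l)
    (hf : f k = f l) (hh : h k = h l) : rowSum f * colSum h = 0 := by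
  have swap_fix : ∀ g : Fin n → ℕ, g k = g l → ∀ i, g (Equiv.swap k l i) = g i := by
    intro g hg i
    by_cases hik : i = k
    · subst hik; simp [hg]
    · by_cases hil : i = l
      · subst hil; simp [hg]
      · rw [Equiv.swap_apply_of_ne_of_ne hik hil]
  -- The transposition of `k` and `l` preserves the fibres of both functions: the row sum absorbs it
  -- and the column sum changes sign.
  have h1 : rowSum f * colSum h = -(rowSum f * colSum h) := by
    conv_lhs => rw [← rowSum_mul_single f (swap_fix f hf), mul_assoc,
      single_mul_colSum h (swap_fix h hh), Equiv.Perm.sign_swap hkl]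
    simp
  have h2 : (2 : ℂ) • (rowSum f * colSum h) = 0 := by
    rw [two_smul]; nth_rewrite 2 [h1]; simp
  exact (smul_eq_zero.1 h2).resolve_left two_ne_zero

/-- The constant coefficient of `rowSum f * colSum h`, for jointly injective `f`, `h`. -/
theorem rowSum_mul_colSum_coeff_one (f h : Fin n → ℕ)
    (hfh : ∀ k l, f k = f l → h k = h l → k = l) :
    (rowSum f * colSum h).coeff 1 = 1 := by
  classical
  simp only [rowSum, colSum, Finset.sum_mul, Finset.mul_sum, MonoidAlgebra.single_mul_single,
    MonoidAlgebra.coeff_sum, MonoidAlgebra.coeff_single, Finsupp.finsetSum_apply, one_mul,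
    Finsupp.single_apply]
  rw [Finset.sum_eq_single 1, Finset.sum_eq_single 1]
  · simp
  · intro p _ hp
    rw [if_neg]; simpa using hp
  · simp
  · intro q hq hq1
    -- If `p * q = 1`, then `q` preserves rows and columns at once, so it fixes every cell.
    refine Finset.sum_eq_zero fun p hp => if_neg fun hpq => hq1 ?_
    simp only [Finset.mem_filter, Finset.mem_univ, true_and] at hp hq
    have : p = q⁻¹ := by
      exact eq_inv_of_mul_eq_one_left hpq
    ext k
    have h1 := hp (q k)
    have h2 := hq k
    rw [this, show q⁻¹ (q k) = k from q.symm_apply_apply k] at h1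
    exact congrArg Fin.val (hfh _ _ h1.symm h2)
  · simp

/-! ### Fillings of Young diagrams -/

/-- The row of `k` in the filling `T`. -/
def fillRow {μ : YoungDiagram} (T : Fin n ≃ μ.cells) (k : Fin n) : ℕ := (T k).1.1

/-- The column of `k` in the filling `T`. -/
def fillCol {μ : YoungDiagram} (T : Fin n ≃ μ.cells) (k : Fin n) : ℕ := (T k).1.2

theorem fill_ext {μ : YoungDiagram} (T : Fin n ≃ μ.cells) {k l : Fin n}
    (h1 : fillRow T k = fillRow T l) (h2 : fillCol T k = fillCol T l) : k = l :=
  T.injective (Subtype.ext (Prod.ext h1 h2))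

theorem card_fillRow_lt {μ : YoungDiagram} (T : Fin n ≃ μ.cells) (r : ℕ) :
    (Finset.univ.filter fun k => fillRow T k < r).card =
      (μ.cells.filter fun c => c.1 < r).card := by
  refine Finset.card_bij (fun k _ => (T k).1) ?_ ?_ ?_
  · intro k hk
    have hk' : (T k).1.1 < r := (Finset.mem_filter.1 hk).2
    exact Finset.mem_filter.2 ⟨(T k).2, hk'⟩
  · intro k _ l _ h
    exact T.injective (Subtype.ext h)
  · intro c hc
    simp only [Finset.mem_filter] at hc
    refine ⟨T.symm ⟨c, hc.1⟩, Finset.mem_filter.2 ⟨Finset.mem_univ _, ?_⟩, by simp⟩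
    simp [fillRow, hc.2]

/-- A column of a Young diagram is an initial segment of length `colLen`, whatever the filling. -/
theorem card_fillRow_lt_fillCol_eq {μ : YoungDiagram} (T : Fin n ≃ μ.cells) (r j : ℕ) :
    (Finset.univ.filter fun k => fillCol T k = j ∧ fillRow T k < r).card =
      min r (μ.colLen j) := by
  rw [← Finset.card_range (min r (μ.colLen j))]
  refine Finset.card_bij (fun k _ => (T k).1.1) ?_ ?_ ?_
  · intro k hk
    simp only [Finset.mem_filter, Finset.mem_univ, true_and] at hk
    simp only [Finset.mem_range, lt_min_iff]
    unfold fillCol fillRow at hk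
    refine ⟨hk.2, YoungDiagram.mem_iff_lt_colLen.1 ?_⟩
    rw [← hk.1]
    exact (T k).2
  · intro k hk l hl h
    simp only [Finset.mem_filter, Finset.mem_univ, true_and] at hk hl
    exact fill_ext T h (hk.1.trans hl.1.symm)
  · intro i hi
    simp only [Finset.mem_range, lt_min_iff] at hi
    refine ⟨T.symm ⟨(i, j), YoungDiagram.mem_iff_lt_colLen.2 hi.2⟩,
      Finset.mem_filter.2 ⟨Finset.mem_univ _, ?_⟩, by simp⟩
    simp [fillCol, fillRow, hi.1]

/-- No two entries in a common row of `f` are in a common column of `T`. -/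
def Separated (f h : Fin n → ℕ) : Prop := ∀ k l, f k = f l → h k = h l → k = l

/-- Separation makes `f` injective on each column of `T`, which gives the bound `r`; the other bound
is the length of the column. -/
theorem card_separated_le {ν : YoungDiagram} {f : Fin n → ℕ} (T : Fin n ≃ ν.cells)
    (hs : Separated f (fillCol T)) (r j : ℕ) :
    (Finset.univ.filter fun k => fillCol T k = j ∧ f k < r).card ≤ min r (ν.colLen j) := by
  refine le_min ?_ ?_
  · rw [← Finset.card_range r]
    refine Finset.card_le_card_of_injOn f ?_ ?_
    · intro k hk
      simpa using (Finset.mem_filter.1 hk).2.2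
    · intro k hk l hl h
      have hk' := (Finset.mem_filter.1 hk).2.1
      have hl' := (Finset.mem_filter.1 hl).2.1
      exact hs k l h (hk'.trans hl'.symm)
  · obtain ⟨R, hR⟩ : ∃ R, ∀ k, fillRow T k < R :=
      ⟨(Finset.univ.sup (fillRow T)) + 1, fun k =>
        Nat.lt_succ_of_le (Finset.le_sup (Finset.mem_univ k))⟩
    calc _ ≤ (Finset.univ.filter fun k => fillCol T k = j ∧ fillRow T k < R).card := by
          refine Finset.card_le_card fun k hk => ?_
          simp only [Finset.mem_filter, Finset.mem_univ, true_and] at hk ⊢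
          exact ⟨hk.1, hR k⟩
      _ ≤ ν.colLen j := by
          rw [card_fillRow_lt_fillCol_eq]
          exact min_le_right _ _

theorem card_filter_eq_sum_fillCol {ν : YoungDiagram} (T : Fin n ≃ ν.cells) (P : Fin n → Prop)
    [DecidablePred P] :
    (Finset.univ.filter P).card = ∑ j ∈ Finset.univ.image (fillCol T),
      (Finset.univ.filter fun k => fillCol T k = j ∧ P k).card := by
  rw [Finset.card_eq_sum_card_fiberwise (f := fillCol T) (t := Finset.univ.image (fillCol T))]
  · refine Finset.sum_congr rfl fun j _ => ?_
    congr 1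
    ext k
    simp [and_comm]
  · intro k _
    simp

/-- Separated fillings exist only if the first shape is dominated by the second one. -/
theorem dominance_of_separated {μ ν : YoungDiagram} (S : Fin n ≃ μ.cells) (T : Fin n ≃ ν.cells)
    (hs : Separated (fillRow S) (fillCol T)) (r : ℕ) :
    (μ.cells.filter fun c => c.1 < r).card ≤ (ν.cells.filter fun c => c.1 < r).card := by
  rw [← card_fillRow_lt S, ← card_fillRow_lt T, card_filter_eq_sum_fillCol T,
    card_filter_eq_sum_fillCol T]
  refine Finset.sum_le_sum fun j _ => ?_
  rw [card_fillRow_lt_fillCol_eq]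
  exact card_separated_le T hs r j

/-- For equal shapes the column-by-column inequalities have the same total on both sides, so each of
them is an equality. -/
theorem card_separated_eq {μ : YoungDiagram} (S T : Fin n ≃ μ.cells)
    (hs : Separated (fillRow S) (fillCol T)) (r : ℕ) (k : Fin n) :
    (Finset.univ.filter fun l => fillCol T l = fillCol T k ∧ fillRow S l < r).card =
      min r (μ.colLen (fillCol T k)) := by
  have hsum : ∑ j ∈ Finset.univ.image (fillCol T),
      (Finset.univ.filter fun l => fillCol T l = j ∧ fillRow S l < r).card =
      ∑ j ∈ Finset.univ.image (fillCol T), min r (μ.colLen j) := by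
    rw [← card_filter_eq_sum_fillCol T, card_fillRow_lt, ← card_fillRow_lt T,
      card_filter_eq_sum_fillCol T]
    exact Finset.sum_congr rfl fun j _ => card_fillRow_lt_fillCol_eq T r j
  exact (Finset.sum_eq_sum_iff_of_le fun j _ => card_separated_le T hs r j).1 hsum _
    (Finset.mem_image_of_mem _ (Finset.mem_univ k))

/-- If the row of `k` were at least the length of its column, the count in that column would already
be saturated at `fillRow S k`, yet `k` itself increases it at the next step. -/
theorem mem_of_separated {μ : YoungDiagram} (S T : Fin n ≃ μ.cells)
    (hs : Separated (fillRow S) (fillCol T)) (k : Fin n) :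
    (fillRow S k, fillCol T k) ∈ μ := by
  rw [YoungDiagram.mem_iff_lt_colLen]
  by_contra hlt
  rw [not_lt] at hlt
  have h1 := card_separated_eq S T hs (fillRow S k) k
  have h2 := card_separated_eq S T hs (fillRow S k + 1) k
  rw [min_eq_right hlt] at h1
  rw [min_eq_right (hlt.trans (Nat.le_succ _)), ← h1] at h2
  refine absurd h2 (Finset.card_lt_card ?_).ne'
  refine Finset.ssubset_iff_subset_ne.2 ⟨?_, fun h => ?_⟩
  · intro l hl
    simp only [Finset.mem_filter, Finset.mem_univ, true_and] at hl ⊢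
    exact ⟨hl.1, hl.2.trans (Nat.lt_succ_self _)⟩
  · have hk : k ∈ Finset.univ.filter fun l =>
        fillCol T l = fillCol T k ∧ fillRow S l < fillRow S k + 1 := by simp
    rw [← h] at hk
    simp at hk

/-- Separated fillings of the same shape agree up to a row and a column permutation. -/
theorem exists_perm_of_separated {μ : YoungDiagram} (S T : Fin n ≃ μ.cells)
    (hs : Separated (fillRow S) (fillCol T)) :
    ∃ p q : Equiv.Perm (Fin n), (∀ k, fillRow S (p k) = fillRow S k) ∧
      (∀ k, fillCol T (q k) = fillCol T k) ∧ ∀ k, S (p k) = T (q k) := by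
  -- `m k` is the cell in the `S`-row and the `T`-column of `k`. Reading it back through `S` gives
  -- the row permutation, through `T` the column permutation.
  let m : Fin n → μ.cells := fun k => ⟨(fillRow S k, fillCol T k), mem_of_separated S T hs k⟩
  have hm : Function.Injective m := fun k l h => by
    have h' : (fillRow S k, fillCol T k) = (fillRow S l, fillCol T l) := congrArg Subtype.val h
    exact hs k l (Prod.mk.inj h').1 (Prod.mk.inj h').2
  have hbij : ∀ U : Fin n ≃ μ.cells, Function.Bijective (U.symm ∘ m) := fun U =>
    Finite.injective_iff_bijective.1 (U.symm.injective.comp hm)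
  refine ⟨Equiv.ofBijective _ (hbij S), Equiv.ofBijective _ (hbij T), fun k => ?_, fun k => ?_,
    fun k => ?_⟩
  · simp [fillRow, m]
  · simp [fillCol, m]
  · simp

end Symmetrizers

/-! ### Homomorphisms between Specht modules -/

noncomputable section SpechtHom

variable {n : ℕ}

theorem Ptn.symmetrizer_eq (μ : Ptn n) :
    μ.symmetrizer = rowSum (fillRow μ.tableau) * colSum (fillCol μ.tableau) := rfl

theorem Ptn.symmetrizer_coeff_one (μ : Ptn n) : μ.symmetrizer.coeff 1 = 1 := by
  rw [Ptn.symmetrizer_eq]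
  exact rowSum_mul_colSum_coeff_one _ _ fun _ _ => fill_ext μ.tableau

theorem Ptn.symmetrizer_ne_zero (μ : Ptn n) : μ.symmetrizer ≠ 0 := fun h => by
  simpa [h] using μ.symmetrizer_coeff_one

theorem rowSum_mul_single_mul_colSum (f h : Fin n → ℕ) (x : Equiv.Perm (Fin n)) :
    rowSum f * MonoidAlgebra.single x 1 * colSum h =
      rowSum f * colSum (h ∘ ⇑x⁻¹) * MonoidAlgebra.single x 1 := by
  rw [mul_assoc, single_mul_colSum_comm, mul_assoc]

theorem rowSum_mul_colSum_of_not_separated {f h : Fin n → ℕ} (hs : ¬ Separated f h) :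
    rowSum f * colSum h = 0 := by
  simp only [Separated, not_forall] at hs
  obtain ⟨k, l, h1, h2, h3⟩ := hs
  exact rowSum_mul_colSum_eq_zero f h h3 h1 h2

/-- Linear conditions on an element of the group algebra may be checked on the group. -/
theorem MonoidAlgebra.mem_of_single_mem {G : Type*} [Group G]
    (p : Submodule ℂ (MonoidAlgebra ℂ G)) (h : ∀ g, MonoidAlgebra.single g 1 ∈ p)
    (x : MonoidAlgebra ℂ G) : x ∈ p := by
  induction x using MonoidAlgebra.induction_on with
  | of g => exact h g
  | add x y hx hy => exact p.add_mem hx hy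
  | smul r x hx => exact p.smul_mem r hx

/-- For a group element `y`, moving it to the right replaces the filling of `ν` by a translate. A
nonzero product would make the two fillings separated and hence force dominance. -/
theorem Ptn.rowSum_mul_colSum_of_not_dominated {μ ν : Ptn n} {r : ℕ}
    (hr : (ν.1.cells.filter fun c => c.1 < r).card < (μ.1.cells.filter fun c => c.1 < r).card)
    (y : MonoidAlgebra ℂ (Equiv.Perm (Fin n))) :
    rowSum (fillRow μ.tableau) * y * colSum (fillCol ν.tableau) = 0 := by
  refine MonoidAlgebra.mem_of_single_mem (LinearMap.ker
    (LinearMap.mulRight ℂ (colSum (fillCol ν.tableau)) ∘ₗ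
      LinearMap.mulLeft ℂ (rowSum (fillRow μ.tableau)))) (fun x => ?_) y
  rw [LinearMap.mem_ker, LinearMap.comp_apply, LinearMap.mulLeft_apply, LinearMap.mulRight_apply,
    rowSum_mul_single_mul_colSum]
  rw [rowSum_mul_colSum_of_not_separated, zero_mul]
  intro hs
  exact absurd hr (not_lt.2 (dominance_of_separated μ.tableau (x⁻¹.trans ν.tableau) hs r))

/-- `a y b` is a multiple of the Young symmetrizer `a b`. -/
theorem Ptn.rowSum_mul_colSum_mem_span (μ : Ptn n)
    (y : MonoidAlgebra ℂ (Equiv.Perm (Fin n))) :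
    rowSum (fillRow μ.tableau) * y * colSum (fillCol μ.tableau) ∈
      Submodule.span ℂ {μ.symmetrizer} := by
  refine MonoidAlgebra.mem_of_single_mem ((Submodule.span ℂ {μ.symmetrizer}).comap
    (LinearMap.mulRight ℂ (colSum (fillCol μ.tableau)) ∘ₗ
      LinearMap.mulLeft ℂ (rowSum (fillRow μ.tableau)))) (fun x => ?_) y
  rw [Submodule.mem_comap, LinearMap.comp_apply, LinearMap.mulLeft_apply,
    LinearMap.mulRight_apply]
  by_cases hs : Separated (fillRow μ.tableau) (fillCol μ.tableau ∘ ⇑x⁻¹)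
  · obtain ⟨p, q, hp, hq, hpq⟩ := exists_perm_of_separated μ.tableau (x⁻¹.trans μ.tableau) hs
    have hpq' : ∀ k, p k = x⁻¹ (q k) := fun k => μ.tableau.injective (hpq k)
    have hp' : ∀ k, fillRow μ.tableau (p⁻¹ k) = fillRow μ.tableau k := fun k => by
      simpa using (hp (p⁻¹ k)).symm
    have hq' : ∀ k, fillCol μ.tableau ((p * x) k) = fillCol μ.tableau k := fun k => by
      rw [Equiv.Perm.mul_apply, hpq']
      simpa [fillCol] using hq (x k)
    -- Here `p * x = x⁻¹ * q * x` preserves columns, so `x` factors as a row permutation times a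
    -- column permutation, absorbed on the left and on the right up to sign.
    have hx : MonoidAlgebra.single x (1 : ℂ) =
        MonoidAlgebra.single p⁻¹ 1 * MonoidAlgebra.single (p * x) 1 := by
      simp [MonoidAlgebra.single_mul_single]
    rw [hx, ← mul_assoc, rowSum_mul_single _ hp', mul_assoc, single_mul_colSum _ hq',
      mul_smul_comm, ← μ.symmetrizer_eq]
    exact Submodule.smul_mem _ _ (Submodule.mem_span_singleton_self _)
  · rw [rowSum_mul_single_mul_colSum, rowSum_mul_colSum_of_not_separated hs, zero_mul]
    exact zero_mem _

theorem MonoidAlgebra.trace_mulRight {G : Type*} [Group G] [Fintype G] (c : MonoidAlgebra ℂ G) :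
    LinearMap.trace ℂ _ (LinearMap.mulRight ℂ c) = Fintype.card G * c.coeff 1 := by
  classical
  rw [LinearMap.trace_eq_matrix_trace ℂ (MonoidAlgebra.basis G ℂ), Matrix.trace]
  have : ∀ g : G, (LinearMap.toMatrix (MonoidAlgebra.basis G ℂ) (MonoidAlgebra.basis G ℂ)
      (LinearMap.mulRight ℂ c)).diag g = c.coeff 1 := by
    intro g
    rw [Matrix.diag_apply, LinearMap.toMatrix_apply, MonoidAlgebra.basis_apply,
      LinearMap.mulRight_apply]
    change (MonoidAlgebra.single g 1 * c).coeff g = _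
    rw [MonoidAlgebra.coeff_single_mul_apply]
    simp
  rw [Finset.sum_congr rfl fun g _ => this g]
  simp

instance {G : Type*} [Finite G] : FiniteDimensional ℂ (MonoidAlgebra ℂ G) :=
  Module.Finite.of_basis (MonoidAlgebra.basis G ℂ)

/-- The square is a multiple of the symmetrizer by `Ptn.rowSum_mul_colSum_mem_span`. Were the factor
zero, right multiplication by the symmetrizer would be nilpotent, but its trace is the order of the
group times the coefficient at `1`, which is `1`. -/
theorem Ptn.exists_symmetrizer_mul_self (μ : Ptn n) :
    ∃ κ : ℂ, κ ≠ 0 ∧ μ.symmetrizer * μ.symmetrizer = κ • μ.symmetrizer := by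
  have h := μ.rowSum_mul_colSum_mem_span
    (colSum (fillCol μ.tableau) * rowSum (fillRow μ.tableau))
  rw [Submodule.mem_span_singleton] at h
  obtain ⟨κ, hκ⟩ := h
  have hmul : μ.symmetrizer * μ.symmetrizer = κ • μ.symmetrizer := by
    rw [hκ, Ptn.symmetrizer_eq]; simp only [mul_assoc]
  refine ⟨κ, fun h0 => ?_, hmul⟩
  rw [h0, zero_smul] at hmul
  have hnil : IsNilpotent (LinearMap.mulRight ℂ μ.symmetrizer) :=
    ⟨2, by
      rw [pow_two]
      refine LinearMap.ext fun x => ?_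
      rw [Module.End.mul_apply, LinearMap.mulRight_apply, LinearMap.mulRight_apply, mul_assoc,
        hmul, mul_zero, LinearMap.zero_apply]⟩
  have htr := (LinearMap.isNilpotent_trace_of_isNilpotent hnil).eq_zero
  rw [MonoidAlgebra.trace_mulRight, μ.symmetrizer_coeff_one, mul_one] at htr
  exact Fintype.card_ne_zero (Nat.cast_eq_zero.1 htr)

theorem Ptn.coe_rep_apply (μ : Ptn n) (g : Equiv.Perm (Fin n)) (x : μ.specht) :
    ((μ.rep g x : μ.specht) : MonoidAlgebra ℂ (Equiv.Perm (Fin n))) =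
      MonoidAlgebra.single g 1 * (x : MonoidAlgebra ℂ (Equiv.Perm (Fin n))) := rfl

/-- The element `y * c` of the Specht module generated by `c`. -/
def Ptn.mulGen (μ : Ptn n) : MonoidAlgebra ℂ (Equiv.Perm (Fin n)) →ₗ[ℂ] μ.specht :=
  (LinearMap.mulRight ℂ μ.symmetrizer).rangeRestrict

theorem Ptn.coe_mulGen (μ : Ptn n) (y : MonoidAlgebra ℂ (Equiv.Perm (Fin n))) :
    (μ.mulGen y : MonoidAlgebra ℂ (Equiv.Perm (Fin n))) = y * μ.symmetrizer := rfl

theorem Ptn.mulGen_surjective (μ : Ptn n) : Function.Surjective μ.mulGen :=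
  LinearMap.surjective_rangeRestrict _

/-- An intertwining map is linear over the group algebra, so the image of the generator determines
it. -/
theorem Ptn.coe_intertwining_mulGen {μ ν : Ptn n} (φ : Representation.IntertwiningMap μ.rep ν.rep)
    (y : MonoidAlgebra ℂ (Equiv.Perm (Fin n))) :
    (φ (μ.mulGen y) : MonoidAlgebra ℂ (Equiv.Perm (Fin n))) = y * φ (μ.mulGen 1) := by
  have := MonoidAlgebra.mem_of_single_mem (LinearMap.eqLocus
    (ν.specht.subtype ∘ₗ φ.toLinearMap ∘ₗ μ.mulGen)
    (LinearMap.mulRight ℂ (φ (μ.mulGen 1) : MonoidAlgebra ℂ (Equiv.Perm (Fin n))))) ?_ y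
  · exact this
  · intro g
    rw [LinearMap.mem_eqLocus]
    have h : μ.mulGen (MonoidAlgebra.single g 1) = μ.rep g (μ.mulGen 1) := by
      apply Subtype.ext
      rw [Ptn.coe_rep_apply, Ptn.coe_mulGen, Ptn.coe_mulGen, one_mul]
    change ((φ (μ.mulGen (MonoidAlgebra.single g 1)) : ν.specht) :
      MonoidAlgebra ℂ (Equiv.Perm (Fin n))) = MonoidAlgebra.single g 1 *
        ((φ (μ.mulGen 1) : ν.specht) : MonoidAlgebra ℂ (Equiv.Perm (Fin n)))
    rw [h, φ.isIntertwining, Ptn.coe_rep_apply]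

/-- The symmetrizer is idempotent up to a nonzero scalar, so the image of the generator is fixed, up
to that scalar, by left multiplication with it. Questions about homomorphisms become questions about
products of a row sum, an element and a column sum. -/
theorem Ptn.intertwining_gen {μ ν : Ptn n} (φ : Representation.IntertwiningMap μ.rep ν.rep) :
    ∃ y, (φ (μ.mulGen 1) : MonoidAlgebra ℂ (Equiv.Perm (Fin n))) =
      rowSum (fillRow μ.tableau) * y * colSum (fillCol ν.tableau) := by
  obtain ⟨κ, hκ, h⟩ := μ.exists_symmetrizer_mul_self
  have h1 := Ptn.coe_intertwining_mulGen φ μ.symmetrizer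
  have h2 : μ.mulGen μ.symmetrizer = κ • μ.mulGen 1 := by
    apply Subtype.ext
    rw [Ptn.coe_mulGen, h]
    simp [Ptn.coe_mulGen]
  obtain ⟨z, hz⟩ := (φ (μ.mulGen 1)).2
  refine ⟨κ⁻¹ • (colSum (fillCol μ.tableau) * z * rowSum (fillRow ν.tableau)), ?_⟩
  rw [h2, map_smul, Submodule.coe_smul, ← hz, LinearMap.mulRight_apply, Ptn.symmetrizer_eq,
    Ptn.symmetrizer_eq] at h1
  rw [← hz, LinearMap.mulRight_apply, Ptn.symmetrizer_eq, mul_smul_comm, smul_mul_assoc,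
    eq_inv_smul_iff₀ hκ, h1]
  simp only [mul_assoc]

theorem Ptn.intertwining_eq_zero_iff {μ ν : Ptn n}
    (φ : Representation.IntertwiningMap μ.rep ν.rep) : φ = 0 ↔ φ (μ.mulGen 1) = 0 := by
  refine ⟨fun h => by rw [h]; rfl, fun h => ?_⟩
  refine Representation.IntertwiningMap.ext (LinearMap.ext fun x => ?_)
  obtain ⟨y, rfl⟩ := μ.mulGen_surjective x
  apply Subtype.ext
  have := Ptn.coe_intertwining_mulGen φ y
  rw [h, Submodule.coe_zero, mul_zero] at this
  exact this

theorem Ptn.intertwining_eq_zero_of_not_dominated {μ ν : Ptn n} {r : ℕ}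
    (hr : (ν.1.cells.filter fun c => c.1 < r).card < (μ.1.cells.filter fun c => c.1 < r).card)
    (φ : Representation.IntertwiningMap μ.rep ν.rep) : φ = 0 := by
  rw [Ptn.intertwining_eq_zero_iff]
  obtain ⟨y, hy⟩ := Ptn.intertwining_gen φ
  rw [Ptn.rowSum_mul_colSum_of_not_dominated hr] at hy
  exact Subtype.ext hy

/-- Schur's lemma for Specht modules. -/
theorem Ptn.intertwining_eq_smul (μ : Ptn n) (φ : Representation.IntertwiningMap μ.rep μ.rep) :
    ∃ s : ℂ, ∀ x, φ x = s • x := by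
  obtain ⟨y, hy⟩ := Ptn.intertwining_gen φ
  obtain ⟨s, hs⟩ := Submodule.mem_span_singleton.1 (μ.rowSum_mul_colSum_mem_span y)
  refine ⟨s, fun x => ?_⟩
  obtain ⟨z, rfl⟩ := μ.mulGen_surjective x
  apply Subtype.ext
  rw [Ptn.coe_intertwining_mulGen, hy, ← hs, Submodule.coe_smul, Ptn.coe_mulGen, mul_smul_comm]

end SpechtHom

/-! ### Characters of the symmetric group -/

noncomputable section SymmetricCharacters

variable {n : ℕ}

theorem Ptn.transpose_transpose (μ : Ptn n) : μ.transpose.transpose = μ :=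
  Subtype.ext (YoungDiagram.transpose_transpose μ.1)

theorem YoungDiagram.card_cells_filter_succ (μ : YoungDiagram) (r : ℕ) :
    (μ.cells.filter fun c => c.1 < r + 1).card =
      (μ.cells.filter fun c => c.1 < r).card + μ.rowLen r := by
  rw [YoungDiagram.rowLen_eq_card, YoungDiagram.row, ← Finset.card_union_of_disjoint]
  · congr 1
    ext c
    simp only [Finset.mem_filter, Finset.mem_union, Nat.lt_succ_iff_lt_or_eq]
    tauto
  · rw [Finset.disjoint_filter]
    intro c _ h1 h2
    omega

/-- Consecutive differences of these counts are the row lengths, which determine the diagram. -/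
theorem Ptn.exists_card_ne {μ ν : Ptn n} (h : μ ≠ ν) : ∃ r,
    (μ.1.cells.filter fun c => c.1 < r).card ≠ (ν.1.cells.filter fun c => c.1 < r).card := by
  by_contra! hr
  refine h (Subtype.ext (YoungDiagram.ext (Finset.ext fun c => ?_)))
  have h1 := hr (c.1 + 1)
  rw [YoungDiagram.card_cells_filter_succ, YoungDiagram.card_cells_filter_succ, hr c.1] at h1
  rw [YoungDiagram.mem_cells, YoungDiagram.mem_cells, ← Prod.mk.eta (p := c),
    YoungDiagram.mem_iff_lt_rowLen, YoungDiagram.mem_iff_lt_rowLen, Nat.add_left_cancel h1]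

/-- A permutation and its inverse have the same cycle type. This lets characters be paired
bilinearly, without an inverse, as in the elliptic pairing. -/
theorem Equiv.Perm.character_inv {V : Type*} [AddCommGroup V] [Module ℂ V]
    (ρ : Representation ℂ (Equiv.Perm (Fin n)) V) (g : Equiv.Perm (Fin n)) :
    ρ.character g⁻¹ = ρ.character g := by
  have : IsConj g g⁻¹ := Equiv.Perm.isConj_iff_cycleType_eq.2 (Equiv.Perm.cycleType_inv g).symm
  obtain ⟨c, hc⟩ := isConj_iff.1 this
  rw [← hc, Representation.char_conj]

theorem Ptn.finrank_intertwining_self (μ : Ptn n) :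
    Module.finrank ℂ (Representation.IntertwiningMap μ.rep μ.rep) = 1 := by
  refine finrank_eq_one (⟨LinearMap.id, fun g => by simp⟩ :
    Representation.IntertwiningMap μ.rep μ.rep) (fun h => ?_) fun φ => ?_
  · have h1 : μ.mulGen 1 = 0 := congrArg (fun φ : Representation.IntertwiningMap μ.rep μ.rep =>
      φ (μ.mulGen 1)) h
    have h2 := congrArg Subtype.val h1
    rw [Ptn.coe_mulGen, one_mul] at h2
    exact μ.symmetrizer_ne_zero h2
  · obtain ⟨s, hs⟩ := μ.intertwining_eq_smul φ
    exact ⟨s, Representation.IntertwiningMap.ext (LinearMap.ext fun x => (hs x).symm)⟩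

theorem Ptn.sum_character_mul_eq_finrank (μ ν : Ptn n) :
    (Nat.card (Equiv.Perm (Fin n)) : ℂ)⁻¹ * ∑ g, μ.rep.character g * ν.rep.character g =
      Module.finrank ℂ (Representation.IntertwiningMap ν.rep μ.rep) := by
  have : Invertible (Nat.card (Equiv.Perm (Fin n)) : ℂ) :=
    invertibleOfNonzero (Nat.cast_ne_zero.2 Nat.card_pos.ne')
  rw [← Representation.card_inv_mul_sum_char_mul_char_eq_finrank]
  simp only [Equiv.Perm.character_inv]

/-- The irreducible characters of the symmetric group are orthonormal. -/
theorem Ptn.sum_character_mul (μ ν : Ptn n) [Decidable (μ = ν)] :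
    (Nat.card (Equiv.Perm (Fin n)) : ℂ)⁻¹ * ∑ g, μ.rep.character g * ν.rep.character g =
      if μ = ν then 1 else 0 := by
  split_ifs with h
  · subst h
    rw [Ptn.sum_character_mul_eq_finrank, Ptn.finrank_intertwining_self, Nat.cast_one]
  · have key : ∀ {μ ν : Ptn n} {r : ℕ}, (μ.1.cells.filter fun c => c.1 < r).card <
        (ν.1.cells.filter fun c => c.1 < r).card →
        Module.finrank ℂ (Representation.IntertwiningMap ν.rep μ.rep) = 0 := by
      intro μ ν r hr
      have : Subsingleton (Representation.IntertwiningMap ν.rep μ.rep) :=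
        subsingleton_of_forall_eq 0 fun φ => Ptn.intertwining_eq_zero_of_not_dominated hr φ
      exact Module.finrank_zero_of_subsingleton
    -- Failure of dominance kills homomorphisms in one direction only; the symmetry of the sum
    -- allows choosing that direction.
    obtain ⟨r, hr⟩ := Ptn.exists_card_ne h
    rcases lt_or_gt_of_ne hr with hr | hr
    · rw [Ptn.sum_character_mul_eq_finrank, key hr, Nat.cast_zero]
    · simp_rw [mul_comm (μ.rep.character _)]
      rw [Ptn.sum_character_mul_eq_finrank, key hr, Nat.cast_zero]

/-! ### Twisting by the sign character -/

/-- The automorphism `g ↦ sgn(g) g` of the group algebra. -/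
def signTwist (n : ℕ) : MonoidAlgebra ℂ (Equiv.Perm (Fin n)) →ₐ[ℂ]
    MonoidAlgebra ℂ (Equiv.Perm (Fin n)) :=
  MonoidAlgebra.lift ℂ _ _
    { toFun := fun g => MonoidAlgebra.single g (((Equiv.Perm.sign g : ℤˣ) : ℤ) : ℂ)
      map_one' := by simp [MonoidAlgebra.one_def]
      map_mul' := fun g h => by simp [MonoidAlgebra.single_mul_single] }

theorem signTwist_single (g : Equiv.Perm (Fin n)) (a : ℂ) :
    signTwist n (MonoidAlgebra.single g a) =
      MonoidAlgebra.single g (a * ((Equiv.Perm.sign g : ℤˣ) : ℤ)) := by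
  simp [signTwist, MonoidAlgebra.lift_single]

theorem signTwist_signTwist (x : MonoidAlgebra ℂ (Equiv.Perm (Fin n))) :
    signTwist n (signTwist n x) = x := by
  have := MonoidAlgebra.mem_of_single_mem (LinearMap.eqLocus
    ((signTwist n).toLinearMap ∘ₗ (signTwist n).toLinearMap) LinearMap.id) ?_ x
  · exact this
  · intro g
    rw [LinearMap.mem_eqLocus]
    simp only [LinearMap.comp_apply, AlgHom.toLinearMap_apply, signTwist_single, LinearMap.id_apply]
    rw [mul_assoc, ← Int.cast_mul, ← Units.val_mul, Int.units_mul_self]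
    simp

theorem signTwist_rowSum (f : Fin n → ℕ) : signTwist n (rowSum f) = colSum f := by
  simp [rowSum, colSum, signTwist_single]

theorem signTwist_colSum (f : Fin n → ℕ) : signTwist n (colSum f) = rowSum f := by
  rw [← signTwist_rowSum, signTwist_signTwist]

/-- The relabelling which turns the filling of `μ` into the filling of the transpose. -/
def Ptn.transposePerm (μ : Ptn n) : Equiv.Perm (Fin n) :=
  (μ.tableau.trans ((Equiv.prodComm ℕ ℕ).subtypeEquiv fun c => by
    rw [YoungDiagram.mem_cells, YoungDiagram.mem_cells]
    change c ∈ μ.1 ↔ c.swap ∈ μ.1.transpose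
    rw [YoungDiagram.mem_transpose, Prod.swap_swap])).trans μ.transpose.tableau.symm

theorem Ptn.fillRow_transposePerm (μ : Ptn n) :
    fillRow μ.transpose.tableau = fillCol μ.tableau ∘ ⇑μ.transposePerm⁻¹ := by
  have : ∀ k, fillRow μ.transpose.tableau (μ.transposePerm k) = fillCol μ.tableau k := by
    intro k
    simp [fillRow, fillCol, Ptn.transposePerm]
  funext k
  have h := this (μ.transposePerm⁻¹ k)
  simpa using h

theorem Ptn.fillCol_transposePerm (μ : Ptn n) :
    fillCol μ.transpose.tableau = fillRow μ.tableau ∘ ⇑μ.transposePerm⁻¹ := by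
  have : ∀ k, fillCol μ.transpose.tableau (μ.transposePerm k) = fillRow μ.tableau k := by
    intro k
    simp [fillRow, fillCol, Ptn.transposePerm]
  funext k
  have h := this (μ.transposePerm⁻¹ k)
  simpa using h

/-- Transposition exchanges rows and columns up to relabelling, and the sign twist exchanges row
sums and column sums. Together they relate the transposed symmetrizer to the product of the original
two factors in the opposite order. -/
theorem Ptn.symmetrizer_transpose (μ : Ptn n) :
    MonoidAlgebra.single μ.transposePerm⁻¹ 1 * μ.transpose.symmetrizer =
      signTwist n (colSum (fillCol μ.tableau) * rowSum (fillRow μ.tableau)) *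
        MonoidAlgebra.single μ.transposePerm⁻¹ 1 := by
  have h : ∀ x : MonoidAlgebra ℂ (Equiv.Perm (Fin n)),
      MonoidAlgebra.single μ.transposePerm⁻¹ 1 * (MonoidAlgebra.single μ.transposePerm 1 * x) =
        x := fun x => by
    rw [← mul_assoc, MonoidAlgebra.single_mul_single, inv_mul_cancel, mul_one,
      ← MonoidAlgebra.one_def, one_mul]
  have h' : ∀ x : MonoidAlgebra ℂ (Equiv.Perm (Fin n)),
      x * MonoidAlgebra.single μ.transposePerm 1 * MonoidAlgebra.single μ.transposePerm⁻¹ 1 =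
        x := fun x => by
    rw [mul_assoc, MonoidAlgebra.single_mul_single, mul_inv_cancel, mul_one,
      ← MonoidAlgebra.one_def, mul_one]
  rw [map_mul, signTwist_colSum, signTwist_rowSum, Ptn.symmetrizer_eq, Ptn.fillRow_transposePerm,
    Ptn.fillCol_transposePerm]
  have h1 := single_mul_rowSum_comm (fillCol μ.tableau) μ.transposePerm
  have h2 := single_mul_colSum_comm (fillRow μ.tableau) μ.transposePerm
  rw [← h' (rowSum (fillCol μ.tableau ∘ ⇑μ.transposePerm⁻¹)), ← h1, mul_assoc, mul_assoc, h,
    ← h' (colSum (fillRow μ.tableau ∘ ⇑μ.transposePerm⁻¹)), ← h2]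
  simp only [mul_assoc]
  rw [h]

/-- The map from the Specht module of `μ` to that of the transpose. -/
def Ptn.twistMap (μ : Ptn n) : μ.specht →ₗ[ℂ] μ.transpose.specht :=
  -- With `a`, `b` the row and column sums, right multiplication by `a` carries the left ideal of `a
  -- * b` into that of `b * a`, where `Ptn.symmetrizer_transpose` applies.
  LinearMap.restrict ((LinearMap.mulRight ℂ (MonoidAlgebra.single μ.transposePerm⁻¹ 1)) ∘ₗ
    (signTwist n).toLinearMap ∘ₗ LinearMap.mulRight ℂ (rowSum (fillRow μ.tableau))) (by
      rintro _ ⟨y, rfl⟩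
      refine ⟨signTwist n (y * rowSum (fillRow μ.tableau)) *
        MonoidAlgebra.single μ.transposePerm⁻¹ 1, ?_⟩
      simp only [LinearMap.comp_apply, LinearMap.mulRight_apply, AlgHom.toLinearMap_apply]
      rw [mul_assoc, Ptn.symmetrizer_transpose, ← mul_assoc, ← map_mul, Ptn.symmetrizer_eq]
      simp only [mul_assoc])

theorem Ptn.coe_twistMap (μ : Ptn n) (x : μ.specht) :
    (μ.twistMap x : MonoidAlgebra ℂ (Equiv.Perm (Fin n))) =
      signTwist n ((x : MonoidAlgebra ℂ (Equiv.Perm (Fin n))) * rowSum (fillRow μ.tableau)) *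
        MonoidAlgebra.single μ.transposePerm⁻¹ 1 := rfl

theorem Ptn.twistMap_rep (μ : Ptn n) (g : Equiv.Perm (Fin n)) (x : μ.specht) :
    μ.twistMap (μ.rep g x) =
      (((Equiv.Perm.sign g : ℤˣ) : ℤ) : ℂ) • μ.transpose.rep g (μ.twistMap x) := by
  apply Subtype.ext
  rw [Submodule.coe_smul, Ptn.coe_rep_apply, Ptn.coe_twistMap, Ptn.coe_twistMap,
    Ptn.coe_rep_apply, mul_assoc, map_mul, signTwist_single, one_mul, mul_assoc,
    ← smul_mul_assoc, MonoidAlgebra.smul_single, smul_eq_mul, mul_one]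

/-- If `x` is killed by the row sum on its right, it is killed by the whole symmetrizer, which acts
on the Specht module from the right as a nonzero scalar. -/
theorem Ptn.twistMap_injective (μ : Ptn n) : Function.Injective μ.twistMap := by
  rw [injective_iff_map_eq_zero]
  intro x hx
  have hx' := congrArg Subtype.val hx
  rw [Ptn.coe_twistMap, Submodule.coe_zero] at hx'
  have h0 := congrArg (fun z => signTwist n (z * MonoidAlgebra.single μ.transposePerm 1)) hx'
  simp only [mul_assoc, MonoidAlgebra.single_mul_single, inv_mul_cancel, mul_one, zero_mul,
    map_zero] at h0
  rw [← MonoidAlgebra.one_def, mul_one, signTwist_signTwist] at h0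
  obtain ⟨κ, hκ, hmul⟩ := μ.exists_symmetrizer_mul_self
  obtain ⟨y, hy⟩ := x.2
  rw [LinearMap.mulRight_apply] at hy
  have h1 : (x : MonoidAlgebra ℂ (Equiv.Perm (Fin n))) * μ.symmetrizer = 0 := by
    rw [Ptn.symmetrizer_eq, ← mul_assoc, h0, zero_mul]
  rw [← hy, mul_assoc, hmul, mul_smul_comm, hy] at h1
  exact Subtype.ext ((smul_eq_zero.1 h1).resolve_left hκ)

/-- `sgn ⊗ σ_μ` is isomorphic to `σ_ν`, for `ν` the transpose of `μ`. -/
theorem Ptn.exists_signTwist {μ ν : Ptn n} (h : ν = μ.transpose) :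
    ∃ A : μ.specht ≃ₗ[ℂ] ν.specht, ∀ g x,
      A (μ.rep g x) = (((Equiv.Perm.sign g : ℤˣ) : ℤ) : ℂ) • ν.rep g (A x) := by
  subst h
  -- Injections in both directions force equal dimensions, so the twist map is bijective.
  have h1 := LinearMap.finrank_le_finrank_of_injective μ.twistMap_injective
  have h2 := LinearMap.finrank_le_finrank_of_injective μ.transpose.twistMap_injective
  rw [Ptn.transpose_transpose] at h2
  exact ⟨LinearEquiv.ofInjectiveOfFinrankEq _ μ.twistMap_injective (h1.antisymm h2),
    μ.twistMap_rep⟩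

theorem Ptn.character_transpose (μ : Ptn n) (g : Equiv.Perm (Fin n)) :
    μ.transpose.rep.character g =
      (((Equiv.Perm.sign g : ℤˣ) : ℤ) : ℂ) * μ.rep.character g := by
  obtain ⟨A, hA⟩ := Ptn.exists_signTwist (μ := μ) rfl
  have h1 : A.conj (μ.rep g) = (((Equiv.Perm.sign g : ℤˣ) : ℤ) : ℂ) • μ.transpose.rep g := by
    refine LinearMap.ext fun x => ?_
    simp [LinearEquiv.conj_apply, hA]
  have h2 : μ.rep.character g =
      (((Equiv.Perm.sign g : ℤˣ) : ℤ) : ℂ) * μ.transpose.rep.character g := by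
    rw [Representation.character, ← LinearMap.trace_conj' (μ.rep g) A, h1, map_smul, smul_eq_mul]
    rfl
  rw [h2, ← mul_assoc, ← Int.cast_mul, ← Units.val_mul, Int.units_mul_self]
  simp

/-- For a self-transposed partition there is an operator which intertwines `σ_μ` and
`sgn ⊗ σ_μ`, and whose square is a non-zero scalar. -/
theorem Ptn.exists_signTwist_self {μ : Ptn n} (h : μ = μ.transpose) :
    ∃ (A : μ.specht →ₗ[ℂ] μ.specht) (c : ℂ), c ≠ 0 ∧ A * A = c • 1 ∧ ∀ g,
      A * μ.rep g = (((Equiv.Perm.sign g : ℤˣ) : ℤ) : ℂ) • (μ.rep g * A) := by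
  obtain ⟨A, hA⟩ := Ptn.exists_signTwist h
  -- The two signs cancel in the square of `A`, which is then a scalar by Schur's lemma.
  obtain ⟨c, hc⟩ := μ.intertwining_eq_smul ((A.toLinearMap ∘ₗ
    A.toLinearMap).intertwiningMap_of_isIntertwiningMap μ.rep μ.rep fun g v => by
      simp only [LinearMap.comp_apply, LinearEquiv.coe_coe, hA, map_smul, smul_smul]
      rw [← Int.cast_mul, ← Units.val_mul, Int.units_mul_self]
      simp)
  have hc' : ∀ x, A (A x) = c • x := hc
  refine ⟨A.toLinearMap, c, fun h0 => ?_, LinearMap.ext fun x => hc' x, fun g =>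
    LinearMap.ext fun x => hA g x⟩
  have h1 := hc' (μ.mulGen 1)
  rw [h0, zero_smul, LinearEquiv.map_eq_zero_iff, LinearEquiv.map_eq_zero_iff] at h1
  have h2 := congrArg Subtype.val h1
  rw [Ptn.coe_mulGen, one_mul] at h2
  exact μ.symmetrizer_ne_zero h2

end SymmetricCharacters

/-! ### The characters of the Specht modules span the class functions -/

noncomputable section Completeness

variable {n : ℕ}

theorem YoungDiagram.card_cellsOfRowLens (w : List ℕ) :
    (YoungDiagram.cellsOfRowLens w).card = w.sum := by
  induction w with
  | nil => rfl
  | cons a w ih =>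
    rw [YoungDiagram.cellsOfRowLens, Finset.card_union_of_disjoint, Finset.card_map, ih,
      Finset.card_product, Finset.card_singleton, Finset.card_range, one_mul, List.sum_cons]
    rw [Finset.disjoint_left]
    rintro ⟨i, j⟩ h1 h2
    simp only [Finset.mem_product, Finset.mem_singleton, Finset.mem_map] at h1 h2
    obtain ⟨c, -, hc⟩ := h2
    have := congrArg Prod.fst hc
    simp [h1.1] at this

/-- The Young diagram of a permutation, with the cycle lengths as row lengths. -/
def Equiv.Perm.shape (g : Equiv.Perm (Fin n)) : Ptn n :=
  ⟨YoungDiagram.ofRowLens (g.partition.parts.sort (· ≥ ·))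
    (Multiset.pairwise_sort _ _).sortedGE, by
      change (YoungDiagram.cellsOfRowLens _).card = n
      rw [YoungDiagram.card_cellsOfRowLens, ← Multiset.sum_coe, Multiset.sort_eq,
        g.partition.parts_sum, Fintype.card_fin]⟩

theorem Equiv.Perm.shape_eq_iff {g h : Equiv.Perm (Fin n)} : g.shape = h.shape ↔ IsConj g h := by
  rw [Equiv.Perm.partition_eq_of_isConj]
  refine ⟨fun hs => ?_, fun hp => by simp only [Equiv.Perm.shape, hp]⟩
  have h1 : g.shape.1.rowLens = h.shape.1.rowLens := by rw [hs]
  have hpos : ∀ g : Equiv.Perm (Fin n), ∀ x ∈ g.partition.parts.sort (· ≥ ·), 0 < x :=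
    fun g x hx => g.partition.parts_pos ((Multiset.mem_sort _).1 hx)
  simp only [Equiv.Perm.shape] at h1
  rw [YoungDiagram.rowLens_ofRowLens_eq_self (hpos g),
    YoungDiagram.rowLens_ofRowLens_eq_self (hpos h)] at h1
  refine Nat.Partition.ext ?_
  rw [← Multiset.sort_eq g.partition.parts (· ≥ ·), h1, Multiset.sort_eq]

/-- The shape of a conjugacy class of permutations. -/
def ConjClasses.shape (c : ConjClasses (Equiv.Perm (Fin n))) : Ptn n :=
  Quotient.lift Equiv.Perm.shape (fun _ _ h => Equiv.Perm.shape_eq_iff.2 h) c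

theorem ConjClasses.shape_injective :
    Function.Injective (ConjClasses.shape : ConjClasses (Equiv.Perm (Fin n)) → Ptn n) := by
  intro c d
  refine Quotient.inductionOn₂ c d fun g h hgh => ?_
  exact Quotient.sound (Equiv.Perm.shape_eq_iff.1 hgh)

/-- The character of a Specht module as a function on conjugacy classes. -/
def Ptn.classChar (μ : Ptn n) (c : ConjClasses (Equiv.Perm (Fin n))) : ℂ :=
  Quotient.lift μ.rep.character (fun g h hgh => by
    obtain ⟨c, hc⟩ := isConj_iff.1 hgh
    rw [← hc, Representation.char_conj]) c

/-- The bilinear form on class functions. -/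
def classForm (n : ℕ) : (ConjClasses (Equiv.Perm (Fin n)) → ℂ) →ₗ[ℂ]
    (ConjClasses (Equiv.Perm (Fin n)) → ℂ) →ₗ[ℂ] ℂ :=
  LinearMap.mk₂ ℂ (fun u v => (Nat.card (Equiv.Perm (Fin n)) : ℂ)⁻¹ *
      ∑ g, u (ConjClasses.mk g) * v (ConjClasses.mk g))
    (fun u v w => by simp [add_mul, Finset.sum_add_distrib, mul_add])
    (fun a u v => by simp [mul_assoc, Finset.mul_sum, mul_left_comm])
    (fun u v w => by simp [mul_add, Finset.sum_add_distrib])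
    (fun a u v => by simp [Finset.mul_sum, mul_left_comm])

theorem classForm_classChar (μ ν : Ptn n) [Decidable (μ = ν)] :
    classForm n μ.classChar ν.classChar = if μ = ν then 1 else 0 :=
  Ptn.sum_character_mul μ ν

theorem Ptn.linearIndependent_classChar :
    LinearIndependent ℂ (Ptn.classChar : Ptn n → ConjClasses (Equiv.Perm (Fin n)) → ℂ) := by
  classical
  rw [linearIndependent_iff']
  intro s a ha ν hν
  have h := congrArg (fun u => classForm n u ν.classChar) ha
  simpa [map_sum, LinearMap.sum_apply, classForm_classChar, hν] using h

/-- The characters are linearly independent in a finite-dimensional space, so finiteness needs no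
enumeration of diagrams. -/
instance Ptn.instFinite : Finite (Ptn n) := by
  classical
  exact Ptn.linearIndependent_classChar.finite

instance Ptn.instFintype : Fintype (Ptn n) := Fintype.ofFinite _

/-- Independence bounds the number of partitions by the number of conjugacy classes, and cycle types
give the reverse bound. -/
theorem Ptn.span_classChar :
    Submodule.span ℂ (Set.range (Ptn.classChar : Ptn n → _)) = ⊤ := by
  classical
  have hle := Fintype.card_le_of_injective _ (ConjClasses.shape_injective (n := n))
  have hli := Ptn.linearIndependent_classChar (n := n)
  have hle' := hli.fintype_card_le_finrank
  rw [Module.finrank_fintype_fun_eq_card] at hle'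
  exact hli.span_eq_top_of_card_eq_finrank' (by
    rw [Module.finrank_fintype_fun_eq_card]; exact hle'.antisymm hle)

/-- A class function orthogonal to all irreducible characters vanishes. -/
theorem eq_zero_of_sum_mul_character_eq_zero (f : Equiv.Perm (Fin n) → ℂ)
    (hf : ∀ g h, f (h * g * h⁻¹) = f g) (h : ∀ μ : Ptn n, ∑ g, f g * μ.rep.character g = 0) :
    f = 0 := by
  let u : ConjClasses (Equiv.Perm (Fin n)) → ℂ := Quotient.lift f fun g h hgh => by
    obtain ⟨c, hc⟩ := isConj_iff.1 hgh
    rw [← hc, hf]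
  have h1 : ∀ v, classForm n u v = 0 := by
    intro v
    have hv : v ∈ Submodule.span ℂ (Set.range (Ptn.classChar : Ptn n → _)) := by
      rw [Ptn.span_classChar]; trivial
    have hle : Submodule.span ℂ (Set.range (Ptn.classChar : Ptn n → _)) ≤
        LinearMap.ker (classForm n u) := by
      rw [Submodule.span_le]
      rintro _ ⟨μ, rfl⟩
      have h2 : classForm n u μ.classChar =
        (Nat.card (Equiv.Perm (Fin n)) : ℂ)⁻¹ * ∑ g, f g * μ.rep.character g := rfl
      rw [SetLike.mem_coe, LinearMap.mem_ker, h2, h μ, mul_zero]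
    exact hle hv
  -- Pairing with the complex conjugate turns the bilinear form into a positive definite one.
  have h2 : (Nat.card (Equiv.Perm (Fin n)) : ℂ)⁻¹ * ∑ g, f g * (starRingEnd ℂ) (f g) = 0 :=
    h1 fun c => (starRingEnd ℂ) (u c)
  have h3 := (mul_eq_zero.1 h2).resolve_left
    (inv_ne_zero (Nat.cast_ne_zero.2 (Nat.card_pos (α := Equiv.Perm (Fin n))).ne'))
  simp only [Complex.mul_conj] at h3
  rw [← Complex.ofReal_sum, Complex.ofReal_eq_zero,
    Finset.sum_eq_zero_iff_of_nonneg fun g _ => Complex.normSq_nonneg _] at h3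
  exact funext fun g => Complex.normSq_eq_zero.1 (h3 g (Finset.mem_univ g))

end Completeness

/-! ### Sums of determinants over `W(D_n)` -/

noncomputable section SignSums

variable {n : ℕ}

/-- The matrix of a signed permutation. -/
def WB.mat (w : WB n) : Matrix (Fin n) (Fin n) ℝ :=
  fun i j => if w.right⁻¹ i = j then ((w.left i : ℤ) : ℝ) else 0

theorem WB.toMatrix_reflB (w : WB n) : LinearMap.toMatrix' (reflB n w) = WB.mat w := by
  ext i j
  rw [LinearMap.toMatrix'_apply]
  simp [reflB, WB.mat, Pi.single_apply]

theorem WB.det_one_sub_reflB (w : WB n) :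
    LinearMap.det (1 - reflB n w) = (1 - WB.mat w).det := by
  rw [← LinearMap.det_toMatrix', map_sub, WB.toMatrix_reflB, LinearMap.toMatrix'_one]

theorem WB.det_one_sub_reflD (w : WD n) :
    LinearMap.det (1 - reflD n w) = (1 - WB.mat w.1).det :=
  WB.det_one_sub_reflB w.1

theorem WB.mat_mul_transpose (w : WB n) : WB.mat w * (WB.mat w).transpose = 1 := by
  ext i j
  have : ((w.left i : ℤ) : ℝ) * ((w.left i : ℤ) : ℝ) = 1 := by
    rw [← Int.cast_mul, ← Units.val_mul, Int.units_mul_self]; simp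
  by_cases h : i = j
  · subst h
    simp [Matrix.mul_apply, WB.mat, this]
  · simp [Matrix.mul_apply, WB.mat, Matrix.one_apply_ne h]
    exact h

theorem WB.mat_eq (w : WB n) :
    WB.mat w = Matrix.diagonal (fun i => ((w.left i : ℤ) : ℝ)) * (w.right⁻¹).permMatrix ℝ := by
  ext i j
  simp [WB.mat, Matrix.diagonal_mul, Equiv.Perm.permMatrix, PEquiv.toMatrix_apply, eq_comm]

theorem WB.det_mat (w : WB n) :
    (WB.mat w).det = ((signProd n w : ℤ) : ℝ) * ((Equiv.Perm.sign w.right : ℤ) : ℝ) := by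
  rw [WB.mat_eq, Matrix.det_mul, Matrix.det_diagonal, Matrix.det_permutation]
  simp [signProd]

/-- The determinant of `1 - w` only sees even or only odd permutations in `W(D_n)`. -/
theorem WD.det_one_sub_mat (w : WD n) :
    (1 - WB.mat w.1).det =
      (-1) ^ n * ((Equiv.Perm.sign w.1.right : ℤ) : ℝ) * (1 - WB.mat w.1).det := by
  -- Orthogonality gives `1 - w = -w (1 - w)ᵀ`, and on W(D_n) the determinant of `w` is the sign of
  -- its permutation.
  have h1 : (1 - WB.mat w.1) = -(WB.mat w.1 * (1 - WB.mat w.1).transpose) := by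
    rw [Matrix.transpose_sub, Matrix.transpose_one, mul_sub, WB.mat_mul_transpose, mul_one, neg_sub]
  have h2 : signProd n w.1 = 1 := w.2
  conv_lhs => rw [h1, Matrix.det_neg, Matrix.det_mul, Matrix.det_transpose, WB.det_mat, h2]
  simp [mul_assoc]

theorem WB.one_sub_mat_row (e : Fin n → ℤˣ) (p : Equiv.Perm (Fin n)) (i : Fin n) :
    (1 - WB.mat (⟨e, p⟩ : WB n)) i =
      Pi.single i 1 - ((e i : ℤ) : ℝ) • Pi.single (p⁻¹ i) 1 := by
  ext j
  simp [WB.mat, Matrix.one_apply, Pi.single_apply, eq_comm]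

/-- Row `i` of `1 - w` depends only on the sign at `i`, so multilinearity moves the sum over signs
inside the determinant. -/
theorem sum_sign_det (p : Equiv.Perm (Fin n)) (φ : ℤˣ → ℝ) :
    ∑ e : Fin n → ℤˣ, (∏ i, φ (e i)) * (1 - WB.mat (⟨e, p⟩ : WB n)).det =
      Matrix.det fun i => ∑ u : ℤˣ, φ u •
        ((Pi.single i 1 : Fin n → ℝ) - ((u : ℤ) : ℝ) • Pi.single (p⁻¹ i) 1) := by
  have h := (Matrix.detRowAlternating (n := Fin n) (R := ℝ)).toMultilinearMap.map_sum
    (fun i (u : ℤˣ) => φ u •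
      ((Pi.single i 1 : Fin n → ℝ) - ((u : ℤ) : ℝ) • Pi.single (p⁻¹ i) 1))
  refine Eq.trans ?_ h.symm
  refine Finset.sum_congr rfl fun e _ => ?_
  rw [MultilinearMap.map_smul_univ, smul_eq_mul]
  congr 2
  exact funext fun i => WB.one_sub_mat_row e p i

/-- The permutation part of each row cancels between the two signs, leaving twice the identity; the
weighted sum below keeps exactly the other part. -/
theorem sum_det_one_sub (p : Equiv.Perm (Fin n)) :
    ∑ e : Fin n → ℤˣ, (1 - WB.mat (⟨e, p⟩ : WB n)).det = 2 ^ n := by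
  have h := sum_sign_det p fun _ => 1
  simp only [Finset.prod_const_one, one_mul, one_smul] at h
  rw [h]
  have : (fun i => ∑ u : ℤˣ,
      ((Pi.single i 1 : Fin n → ℝ) - ((u : ℤ) : ℝ) • Pi.single (p⁻¹ i) 1)) =
      (2 : ℝ) • (1 : Matrix (Fin n) (Fin n) ℝ) := by
    funext i
    ext j
    rw [UnitsInt.univ]
    simp [Matrix.one_apply, Pi.single_apply, eq_comm]
  rw [this, Matrix.det_smul]
  simp

theorem sum_prod_mul_det_one_sub (p : Equiv.Perm (Fin n)) :
    ∑ e : Fin n → ℤˣ, ((∏ i, e i : ℤˣ) : ℝ) * (1 - WB.mat (⟨e, p⟩ : WB n)).det =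
      (-2) ^ n * ((Equiv.Perm.sign p : ℤ) : ℝ) := by
  have h := sum_sign_det p fun u => ((u : ℤ) : ℝ)
  have h1 : ∀ e : Fin n → ℤˣ, (((∏ i, e i : ℤˣ) : ℤ) : ℝ) = ∏ i, ((e i : ℤ) : ℝ) := by
    intro e; simp
  simp only [h1]
  rw [h]
  have : (fun i => ∑ u : ℤˣ, ((u : ℤ) : ℝ) •
      ((Pi.single i 1 : Fin n → ℝ) - ((u : ℤ) : ℝ) • Pi.single (p⁻¹ i) 1)) =
      (-2 : ℝ) • (p⁻¹).permMatrix ℝ := by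
    funext i
    ext j
    rw [UnitsInt.univ]
    simp [Equiv.Perm.permMatrix, PEquiv.toMatrix_apply, Pi.single_apply, eq_comm]
    split_ifs <;> norm_num
  rw [this, Matrix.det_smul, Matrix.det_permutation]
  simp

theorem sum_WB (F : WB n → ℂ) : ∑ w : WB n, F w =
    ∑ p : Equiv.Perm (Fin n), ∑ e : Fin n → ℤˣ, F ⟨e, p⟩ := by
  rw [Finset.sum_comm, ← Finset.sum_product', Finset.univ_product_univ]
  exact Fintype.sum_equiv SemidirectProduct.equivProd _ _ fun w => rfl

theorem sum_WD (F : WB n → ℂ) : ∑ w : WD n, F w =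
    ∑ p : Equiv.Perm (Fin n), ∑ e : Fin n → ℤˣ,
      (1 + (((∏ i, e i : ℤˣ) : ℤ) : ℂ)) / 2 * F ⟨e, p⟩ := by
  classical
  have h1 : ∑ w : WD n, F w = ∑ w : WB n, if w ∈ WD n then F w else 0 := by
    rw [← Finset.sum_filter]
    exact (Finset.sum_subtype _ (fun w => by simp) _).symm
  rw [h1, sum_WB]
  refine Finset.sum_congr rfl fun p _ => Finset.sum_congr rfl fun e _ => ?_
  have h2 : (⟨e, p⟩ : WB n) ∈ WD n ↔ ∏ i, e i = 1 := Iff.rfl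
  rw [h2]
  rcases Int.units_eq_one_or (∏ i, e i) with h | h
  · rw [if_pos h, h]; simp
  · rw [if_neg (by rw [h]; decide), h]; simp

/-- Half of one plus the product of the signs is the indicator of W(D_n), so the two sums over all
sign changes combine. This reduces the elliptic pairing to S_n. -/
theorem sum_WD_right_mul_det (F : Equiv.Perm (Fin n) → ℂ) :
    ∑ w : WD n, F w.1.right * ((LinearMap.det (1 - reflD n w) : ℝ) : ℂ) =
      2 ^ n / 2 * ∑ p, F p * (1 + (-1) ^ n * ((Equiv.Perm.sign p : ℤ) : ℂ)) := by
  have h1 : ∀ w : WD n, F w.1.right * ((LinearMap.det (1 - reflD n w) : ℝ) : ℂ) =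
    (fun w : WB n => F w.right * (((1 - WB.mat w).det : ℝ) : ℂ)) w.1 := fun w => by
      rw [WB.det_one_sub_reflD]
  rw [Finset.sum_congr rfl fun w _ => h1 w,
    sum_WD fun w : WB n => F w.right * (((1 - WB.mat w).det : ℝ) : ℂ), Finset.mul_sum]
  refine Finset.sum_congr rfl fun p _ => ?_
  have h2 := congrArg (Complex.ofReal) (sum_det_one_sub p)
  have h3 := congrArg (Complex.ofReal) (sum_prod_mul_det_one_sub p)
  push_cast at h2 h3
  have h4 : ∀ e : Fin n → ℤˣ, (1 + (((∏ i, e i : ℤˣ) : ℤ) : ℂ)) / 2 *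
      (F p * (((1 - WB.mat (⟨e, p⟩ : WB n)).det : ℝ) : ℂ)) =
      F p / 2 * (((1 - WB.mat (⟨e, p⟩ : WB n)).det : ℝ) : ℂ) +
      F p / 2 * ((((∏ i, e i : ℤˣ) : ℤ) : ℂ) * (((1 - WB.mat (⟨e, p⟩ : WB n)).det : ℝ) : ℂ)) := by
    intro e; ring
  simp only [h4]
  rw [Finset.sum_add_distrib, ← Finset.mul_sum, ← Finset.mul_sum]
  push_cast
  rw [h2, h3, show (-2 : ℂ) = -1 * 2 by ring, mul_pow]
  ring

theorem card_WD (hn : 0 < n) :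
    (Fintype.card (WD n) : ℂ) = 2 ^ n / 2 * (Fintype.card (Equiv.Perm (Fin n)) : ℂ) := by
  have h := sum_WD (n := n) fun _ => 1
  simp only [Finset.sum_const, Finset.card_univ, nsmul_eq_mul, mul_one] at h
  rw [h]
  have h1 : ∑ e : Fin n → ℤˣ, (((∏ i, e i : ℤˣ) : ℤ) : ℂ) = 0 := by
    have h2 : ∀ e : Fin n → ℤˣ, (((∏ i, e i : ℤˣ) : ℤ) : ℂ) = ∏ i, ((e i : ℤ) : ℂ) := by
      intro e; simp
    simp only [h2]
    have h3 := Finset.prod_univ_sum (fun _ : Fin n => (Finset.univ : Finset ℤˣ))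
      fun _ u => ((u : ℤ) : ℂ)
    rw [Fintype.piFinset_univ] at h3
    rw [← h3]
    refine Finset.prod_eq_zero (Finset.mem_univ ⟨0, hn⟩) ?_
    rw [UnitsInt.univ]
    simp
  rw [← Finset.sum_div, Finset.sum_add_distrib, h1]
  simp
  ring

end SignSums

/-! ### Principal minors of signed permutations -/

noncomputable section Minors

variable {n : ℕ}

/-- The principal minor of a signed permutation on the rows and columns in `S`. -/
def WB.minor (S : Finset (Fin n)) (w : WB n) : ℝ :=
  ((WB.mat w).submatrix (Subtype.val : S → Fin n) (Subtype.val : S → Fin n)).det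

/-- The left side is the characteristic polynomial at `1`, whose coefficients are signed sums of
principal minors. The inner sum is the trace on the `k`-th exterior power. -/
theorem Matrix.det_one_sub_eq_sum_minors (M : Matrix (Fin n) (Fin n) ℝ) :
    (1 - M).det = ∑ k ∈ Finset.range (n + 1), (-1) ^ k *
      ∑ S ∈ Finset.univ.powersetCard k,
        (M.submatrix (Subtype.val : S → Fin n) (Subtype.val : S → Fin n)).det := by
  have h1 : (1 - M).det = M.charpoly.eval 1 := by
    rw [Matrix.eval_charpoly, map_one]
  rw [h1, Polynomial.eval_eq_sum_range, Matrix.charpoly_natDegree_eq_dim, Fintype.card_fin,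
    ← Finset.sum_range_reflect]
  refine Finset.sum_congr rfl fun k hk => ?_
  have hk' : k ≤ Fintype.card (Fin n) := by
    rw [Fintype.card_fin]; exact Nat.lt_succ_iff.1 (Finset.mem_range.1 hk)
  rw [← Matrix.charpoly_coeff_eq_sum_minors M k hk', one_pow, mul_one, Fintype.card_fin,
    Nat.add_sub_cancel]

theorem WB.det_one_sub_eq_sum_minor (w : WB n) :
    (1 - WB.mat w).det = ∑ k ∈ Finset.range (n + 1), (-1) ^ k *
      ∑ S ∈ Finset.univ.powersetCard k, WB.minor S w :=
  Matrix.det_one_sub_eq_sum_minors _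

/-- The elements of `W(D_n)` which preserve the coordinate subspace of `S`. -/
def WD.stab (S : Finset (Fin n)) : Subgroup (WD n) where
  carrier := {w | ∀ i, w.1.right i ∈ S ↔ i ∈ S}
  one_mem' := by simp
  mul_mem' := by
    intro a b ha hb i
    exact (ha _).trans (hb i)
  inv_mem' := by
    intro a ha i
    have := ha (a.1.right⁻¹ i)
    simp only [Subgroup.coe_inv, SemidirectProduct.inv_right]
    rw [← this]
    simp

theorem WD.mem_stab_inv {S : Finset (Fin n)} {w : WD n} (hw : w ∈ WD.stab S) (i : Fin n) :
    w.1.right⁻¹ i ∈ S ↔ i ∈ S := by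
  rw [← hw (w.1.right⁻¹ i)]
  simp

/-- Some row indexed by `S` has its only nonzero entry outside `S`. -/
theorem WD.minor_of_notMem_stab {S : Finset (Fin n)} {w : WD n} (hw : w ∉ WD.stab S) :
    WB.minor S w.1 = 0 := by
  have h1 : ∃ i ∈ S, w.1.right⁻¹ i ∉ S := by
    by_contra! h
    refine hw fun i => ?_
    have hsub : S.map w.1.right⁻¹.toEmbedding ⊆ S := by
      intro j hj
      obtain ⟨i, hi, rfl⟩ := Finset.mem_map.1 hj
      exact h i hi
    have heq := Finset.eq_of_subset_of_card_le hsub (by rw [Finset.card_map])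
    constructor
    · intro hi
      simpa using h _ hi
    · intro hi
      rw [← heq] at hi
      obtain ⟨j, hj, hji⟩ := Finset.mem_map.1 hi
      rw [← hji]
      simpa using hj
  obtain ⟨i, hi, hi'⟩ := h1
  refine Matrix.det_eq_zero_of_row_eq_zero ⟨i, hi⟩ fun j => ?_
  rw [Matrix.submatrix_apply, WB.mat, if_neg]
  rintro h
  exact hi' (h ▸ j.2)

theorem WB.mat_mul (v w : WB n) : WB.mat (v * w) = WB.mat v * WB.mat w := by
  rw [← WB.toMatrix_reflB, ← WB.toMatrix_reflB, ← WB.toMatrix_reflB, map_mul,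
    LinearMap.toMatrix'_mul]

theorem WB.mat_one : WB.mat (1 : WB n) = 1 := by
  rw [← WB.toMatrix_reflB, map_one, LinearMap.toMatrix'_one]

theorem WD.mat_eq_zero {S : Finset (Fin n)} {w : WD n} (hw : w ∈ WD.stab S) {i j : Fin n}
    (hi : i ∈ S) (hj : j ∉ S) : WB.mat w.1 i j = 0 := by
  rw [WB.mat, if_neg]
  rintro rfl
  exact hj ((WD.mem_stab_inv hw i).2 hi)

theorem WD.sum_mat_mul {S : Finset (Fin n)} {w : WD n} (hw : w ∈ WD.stab S) {i : Fin n}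
    (hi : i ∈ S) (f : Fin n → ℝ) :
    ∑ j, WB.mat w.1 i j * f j = ∑ j : S, WB.mat w.1 i j * f j := by
  rw [Finset.univ_eq_attach, Finset.sum_attach S fun j => WB.mat w.1 i j * f j]
  exact (Finset.sum_subset (Finset.subset_univ S) fun j _ hj => by
    rw [WD.mat_eq_zero hw hi hj, zero_mul]).symm

/-- An element of the stabilizer is block diagonal, so its minor on `S` is multiplicative; by
`WD.minor_mul_self` it is a sign character. -/
theorem WD.minor_mul {S : Finset (Fin n)} {v w : WD n} (hv : v ∈ WD.stab S) :
    WB.minor S (v * w).1 = WB.minor S v.1 * WB.minor S w.1 := by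
  rw [WB.minor, WB.minor, WB.minor, ← Matrix.det_mul]
  congr 1
  ext i j
  rw [Subgroup.coe_mul, WB.mat_mul, Matrix.submatrix_apply, Matrix.mul_apply,
    WD.sum_mat_mul hv i.2 fun k => WB.mat w.1 k j]
  rfl

theorem WB.minor_one (S : Finset (Fin n)) : WB.minor S (1 : WB n) = 1 := by
  rw [WB.minor, WB.mat_one, Matrix.submatrix_one _ Subtype.val_injective, Matrix.det_one]

theorem WD.minor_mul_self {S : Finset (Fin n)} {w : WD n} (hw : w ∈ WD.stab S) :
    WB.minor S w.1 * WB.minor S w.1 = 1 := by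
  rw [WB.minor]
  conv_lhs => rw [← Matrix.det_transpose]
  nth_rewrite 1 [← Matrix.det_transpose]
  rw [Matrix.transpose_transpose, ← Matrix.det_mul, ← Matrix.det_one (n := S) (R := ℝ)]
  congr 1
  ext i j
  have h := congrFun (congrFun (WB.mat_mul_transpose w.1) i) j
  rw [Matrix.mul_apply, WD.sum_mat_mul hw i.2 fun k => (WB.mat w.1).transpose k j] at h
  rw [Matrix.mul_apply]
  simp only [Matrix.one_apply, Subtype.ext_iff] at h ⊢
  exact h

theorem Matrix.det_toSquareBlockProp {M : Matrix (Fin n) (Fin n) ℝ} {p : Fin n → Prop}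
    [DecidablePred p] {S : Finset (Fin n)} (h : ∀ i, i ∈ S ↔ p i) :
    (M.toSquareBlockProp p).det =
      (M.submatrix (Subtype.val : S → Fin n) (Subtype.val : S → Fin n)).det :=
  (Matrix.det_submatrix_equiv_self (Equiv.subtypeEquivRight h) (M.toSquareBlockProp p)).symm

/-- The product of the two block determinants is the full determinant, which on W(D_n) is the sign
of the permutation; the minor on `S` is its own inverse. -/
theorem WD.minor_compl {S : Finset (Fin n)} {w : WD n} (hw : w ∈ WD.stab S) :
    WB.minor Sᶜ w.1 = ((Equiv.Perm.sign w.1.right : ℤ) : ℝ) * WB.minor S w.1 := by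
  have h1 : (WB.mat w.1).det = WB.minor S w.1 * WB.minor Sᶜ w.1 := by
    rw [Matrix.twoBlockTriangular_det' (WB.mat w.1) (fun i => i ∈ S)
      fun i hi j hj => WD.mat_eq_zero hw hi hj]
    rw [Matrix.det_toSquareBlockProp (S := S) fun _ => Iff.rfl,
      Matrix.det_toSquareBlockProp (S := Sᶜ) fun _ => Finset.mem_compl]
    rfl
  have h2 : signProd n w.1 = 1 := w.2
  rw [WB.det_mat, h2] at h1
  have h3 := WD.minor_mul_self hw
  calc WB.minor Sᶜ w.1 = (WB.minor S w.1 * WB.minor S w.1) * WB.minor Sᶜ w.1 := by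
        rw [h3, one_mul]
    _ = WB.minor S w.1 * (WB.minor S w.1 * WB.minor Sᶜ w.1) := by ring
    _ = _ := by rw [← h1]; simp [mul_comm]

/-- A permutation as an element of `W(D_n)`. -/
def WD.ofPerm (t : Equiv.Perm (Fin n)) : WD n :=
  ⟨SemidirectProduct.inr t, by simp [WD, MonoidHom.mem_ker, signProd]⟩

theorem WD.ofPerm_mul (s t : Equiv.Perm (Fin n)) :
    WD.ofPerm (s * t) = WD.ofPerm s * WD.ofPerm t :=
  Subtype.ext (map_mul SemidirectProduct.inr s t)

theorem WD.ofPerm_one : WD.ofPerm (1 : Equiv.Perm (Fin n)) = 1 :=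
  Subtype.ext (map_one SemidirectProduct.inr)

theorem WD.mat_ofPerm (t : Equiv.Perm (Fin n)) (i j : Fin n) :
    WB.mat (WD.ofPerm t).1 i j = if t⁻¹ i = j then 1 else 0 := by
  simp [WB.mat, WD.ofPerm]

theorem WD.mat_conj (t : Equiv.Perm (Fin n)) (w : WD n) (i j : Fin n) :
    WB.mat (WD.ofPerm t * w * (WD.ofPerm t)⁻¹).1 (t i) (t j) = WB.mat w.1 i j := by
  have h1 : (WD.ofPerm t)⁻¹ = WD.ofPerm t⁻¹ := by
    rw [inv_eq_iff_mul_eq_one, ← WD.ofPerm_mul, mul_inv_cancel, WD.ofPerm_one]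
  rw [h1, Subgroup.coe_mul, Subgroup.coe_mul, WB.mat_mul, WB.mat_mul]
  simp [Matrix.mul_apply, WD.mat_ofPerm]

theorem WD.minor_conj (S : Finset (Fin n)) (t : Equiv.Perm (Fin n)) (w : WD n) :
    WB.minor (S.map t.toEmbedding) (WD.ofPerm t * w * (WD.ofPerm t)⁻¹).1 = WB.minor S w.1 := by
  let e : S ≃ (S.map t.toEmbedding : Finset (Fin n)) := t.subtypeEquiv fun i => by simp
  rw [WB.minor, ← Matrix.det_submatrix_equiv_self e, WB.minor]
  congr 1
  ext i j
  exact WD.mat_conj t w i j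

theorem exists_perm_map_eq {S T : Finset (Fin n)} (h : S.card = T.card) :
    ∃ t : Equiv.Perm (Fin n), S.map t.toEmbedding = T := by
  classical
  let e : {i // i ∈ S} ≃ {i // i ∈ T} := Finset.equivOfCardEq h
  refine ⟨e.extendSubtype, Finset.eq_of_subset_of_card_le ?_ ?_⟩
  · intro j hj
    obtain ⟨i, hi, rfl⟩ := Finset.mem_map.1 hj
    exact e.extendSubtype_mem i hi
  · rw [Finset.card_map, h]

/-- Orbit counting: the permutations in W(D_n) act transitively on subsets of a given size. -/
theorem WD.card_stab_mul_choose (S : Finset (Fin n)) :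
    Nat.card (WD.stab S) * n.choose S.card = Nat.card (WD n) := by
  classical
  have h1 : (Finset.univ : Finset (WD n)).card = ∑ T ∈ Finset.univ.powersetCard S.card,
      (Finset.univ.filter fun w : WD n => S.map w.1.right.toEmbedding = T).card :=
    Finset.card_eq_sum_card_fiberwise fun w _ => by simp [Finset.mem_powersetCard]
  have h2 : ∀ T ∈ Finset.univ.powersetCard S.card,
      (Finset.univ.filter fun w : WD n => S.map w.1.right.toEmbedding = T).card =
        Nat.card (WD.stab S) := by
    intro T hT
    obtain ⟨t, rfl⟩ := exists_perm_map_eq (Finset.mem_powersetCard.1 hT).2.symm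
    rw [Nat.card_eq_fintype_card, Fintype.card_subtype]
    refine Finset.card_bij' (fun w _ => (WD.ofPerm t)⁻¹ * w) (fun w _ => WD.ofPerm t * w)
      ?_ ?_ (by simp) (by simp)
    · intro w hw
      have hw' := (Finset.mem_filter.1 hw).2
      refine Finset.mem_filter.2 ⟨Finset.mem_univ _, fun i => ?_⟩
      have h3 : w.1.right i ∈ S.map w.1.right.toEmbedding ↔ i ∈ S := by simp
      rw [← h3, hw']
      have h4 : ((WD.ofPerm t)⁻¹ * w).1.right i = t.symm (w.1.right i) := rfl
      rw [h4]
      simp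
    · intro w hw
      have hw' : w ∈ WD.stab S := (Finset.mem_filter.1 hw).2
      refine Finset.mem_filter.2 ⟨Finset.mem_univ _, ?_⟩
      refine Finset.eq_of_subset_of_card_le ?_ (by simp)
      intro j hj
      obtain ⟨i, hi, rfl⟩ := Finset.mem_map.1 hj
      exact Finset.mem_map.2 ⟨w.1.right i, (hw' i).2 hi, rfl⟩
  rw [Finset.sum_congr rfl h2, Finset.sum_const, Finset.card_powersetCard, Finset.card_univ,
    Finset.card_univ, Fintype.card_fin, smul_eq_mul] at h1
  rw [Nat.card_eq_fintype_card (α := WD n), h1, mul_comm]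

end Minors

/-! ### Integrality of the elliptic pairing -/

noncomputable section Integrality

variable {n : ℕ}

theorem LinearMap.exists_nat_trace {V : Type*} [AddCommGroup V] [Module ℂ V]
    [FiniteDimensional ℂ V] {P : V →ₗ[ℂ] V} (hP : IsIdempotentElem P) :
    ∃ m : ℕ, LinearMap.trace ℂ V P = m :=
  ⟨_, (LinearMap.isProj_range_iff_isIdempotentElem P |>.2 hP).trace⟩

section Average

variable {G V : Type*} [Group G] [Fintype G] [AddCommGroup V] [Module ℂ V]
  [FiniteDimensional ℂ V] (ρ : Representation ℂ G V)

theorem Representation.exists_nat_sum_character :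
    ∃ m : ℕ, ∑ g, ρ.character g = Nat.card G * m := by
  have : Invertible (Nat.card G : ℂ) := invertibleOfNonzero (Nat.cast_ne_zero.2 Nat.card_pos.ne')
  refine ⟨Module.finrank ℂ ρ.invariants, ?_⟩
  rw [← ρ.card_inv_mul_sum_char_eq_finrank, mul_inv_cancel_left₀]
  exact Nat.cast_ne_zero.2 Nat.card_pos.ne'

/-- The space of invariants is even-dimensional if there is a symmetry of it of trace zero, with
square a non-zero scalar. -/
theorem Representation.exists_nat_sum_character_even (T : V →ₗ[ℂ] V) (c : ℂ) (hc : c ≠ 0)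
    (hT : T * T = c • 1) (σ : G ≃ G) (hσ : ∀ g, T * ρ g = ρ (σ g) * T)
    (htr : ∀ g, LinearMap.trace ℂ V (T * ρ g) = 0) :
    ∃ m : ℕ, ∑ g, ρ.character g = Nat.card G * (2 * m) := by
  have hcard : (Nat.card G : ℂ) ≠ 0 := Nat.cast_ne_zero.2 Nat.card_pos.ne'
  set N : V →ₗ[ℂ] V := ∑ g, ρ g with hN
  have hρN : ∀ g, ρ g * N = N := fun g => by
    rw [hN, Finset.mul_sum]
    simp only [← map_mul]
    exact Fintype.sum_equiv (Equiv.mulLeft g) _ _ fun _ => rfl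
  have hTN : T * N = N * T := by
    rw [hN, Finset.mul_sum, Finset.sum_mul]
    simp only [hσ]
    exact Fintype.sum_equiv σ _ _ fun _ => rfl
  set P : V →ₗ[ℂ] V := (Nat.card G : ℂ)⁻¹ • N with hPdef
  have hPP : P * P = P := by
    have hNN : N * N = (Nat.card G : ℂ) • N := by
      nth_rewrite 1 [hN]
      rw [Finset.sum_mul, Finset.sum_congr rfl fun g _ => hρN g]
      simp [Nat.card_eq_fintype_card, Nat.cast_smul_eq_nsmul]
    rw [hPdef, smul_mul_smul_comm, hNN, smul_smul, mul_assoc, inv_mul_cancel₀ hcard, mul_one]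
  have hTP : T * P = P * T := by
    rw [hPdef, mul_smul_comm, smul_mul_assoc, hTN]
  have htrTP : LinearMap.trace ℂ V (T * P) = 0 := by
    rw [hPdef, mul_smul_comm, map_smul, hN, Finset.mul_sum, map_sum,
      Finset.sum_eq_zero fun g _ => htr g, smul_zero]
  have h5 : LinearMap.trace ℂ V P = (Nat.card G : ℂ)⁻¹ * ∑ g, ρ.character g := by
    rw [hPdef, map_smul, hN, map_sum]; rfl
  clear_value P
  -- `P` projects onto the invariants and commutes with `T`. For `d ^ 2 = c`, half of `P + d⁻¹ T P`
  -- projects onto the `d`-eigenspace of `T` there. As `T P` has trace zero, its rank is half that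
  -- of `P`.
  obtain ⟨d, hd⟩ := IsAlgClosed.exists_pow_nat_eq c two_pos
  have hd0 : d ≠ 0 := by rintro rfl; exact hc (by rw [← hd]; simp)
  have hQ : IsIdempotentElem ((2 : ℂ)⁻¹ • (P + d⁻¹ • (T * P))) := by
    have h2 : P * (T * P) = T * P := by rw [← mul_assoc, ← hTP, mul_assoc, hPP]
    have h1 : T * P * (T * P) = c • P := by
      rw [mul_assoc, h2, ← mul_assoc, hT, smul_mul_assoc, one_mul]
    have h3 : T * P * P = T * P := by rw [mul_assoc, hPP]
    rw [IsIdempotentElem, smul_mul_smul_comm, add_mul, mul_add, mul_add, hPP, smul_mul_smul_comm,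
      h1, mul_smul_comm, smul_mul_assoc, h2, h3, smul_smul, ← hd]
    have h4 : d⁻¹ * d⁻¹ * d ^ 2 = 1 := by field_simp
    rw [h4, one_smul]
    module
  obtain ⟨m, hm⟩ := LinearMap.exists_nat_trace hQ
  rw [map_smul, map_add, map_smul, htrTP, smul_zero, add_zero, smul_eq_mul] at hm
  refine ⟨m, ?_⟩
  rw [h5] at hm
  rw [← hm]
  field_simp

end Average

/-- A permutation which exchanges a set with its complement commutes with an odd permutation. -/
theorem Equiv.Perm.exists_commute_sign_neg {α : Type*} [Fintype α] [DecidableEq α] [Nonempty α]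
    (S : Finset α) (u : Equiv.Perm α) (hu : ∀ i, u i ∈ S ↔ i ∉ S) :
    ∃ v : Equiv.Perm α, Commute v u ∧ Equiv.Perm.sign v = -1 := by
  obtain ⟨x⟩ := ‹Nonempty α›
  have hx : u x ≠ x := fun h => by
    have := hu x
    rw [h] at this
    tauto
  have hcyc := Equiv.Perm.isCycle_cycleOf u hx
  refine ⟨u.cycleOf x, ?_, ?_⟩
  -- The witness is the cycle of `u` through `x`. It alternates between `S` and the complement, so
  -- its length is even and its sign is -1.
  · refine Equiv.ext fun y => ?_
    simp only [Equiv.Perm.mul_apply, Equiv.Perm.cycleOf_apply, Equiv.Perm.sameCycle_apply_right]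
    split_ifs <;> rfl
  · have hpow : ∀ k, ((u.cycleOf x ^ k) x ∈ S ↔ x ∈ S) ↔ Even k := by
      intro k
      rw [Equiv.Perm.cycleOf_pow_apply_self]
      induction k with
      | zero => simp
      | succ k ih =>
        rw [pow_succ', Equiv.Perm.mul_apply, hu, Nat.even_add_one, ← ih]
        tauto
    have heven : Even (orderOf (u.cycleOf x)) := by
      rw [← hpow, pow_orderOf_eq_one]
      simp
    rw [hcyc.sign, ← hcyc.orderOf, heven.neg_one_pow]

theorem Ptn.character_repD (μ : Ptn n) (w : WD n) :
    μ.repD.character w = μ.rep.character w.1.right := rfl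

theorem RepGroup.character_mk {G : Type} [Group G] (V : FDRep ℂ G) :
    RepGroup.character G (RepGroup.mk V) = V.character :=
  (QuotientAddGroup.lift_mk _ _ _).trans (FreeAbelianGroup.lift_apply_of _ _)

theorem ellipticPairing_mk (V : FDRep ℂ (WD n)) (U : FDRep ℂ (WD n)) :
    ellipticPairing (reflD n) (RepGroup.mk V) (RepGroup.mk U) =
      (Fintype.card (WD n) : ℂ)⁻¹ * ∑ w : WD n, V.character w * U.character w *
        ((LinearMap.det (1 - reflD n w) : ℝ) : ℂ) := by
  rw [← RepGroup.character_mk V, ← RepGroup.character_mk U]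
  rfl

instance WD.instFintypeStab (S : Finset (Fin n)) : Fintype (WD.stab S) := Fintype.ofFinite _

/-- The contribution of the coordinate subspace of `S` to the elliptic pairing. -/
def minorSum (V : FDRep ℂ (WD n)) (μ : Ptn n) (S : Finset (Fin n)) : ℂ :=
  ∑ w : WD n, V.character w * μ.rep.character w.1.right * (WB.minor S w.1 : ℂ)

theorem minorSum_map (V : FDRep ℂ (WD n)) (μ : Ptn n) (S : Finset (Fin n))
    (t : Equiv.Perm (Fin n)) : minorSum V μ (S.map t.toEmbedding) = minorSum V μ S := by
  refine (Fintype.sum_equiv (MulAut.conj (WD.ofPerm t)).toEquiv _ _ fun w => ?_).symm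
  have h1 : (MulAut.conj (WD.ofPerm t)).toEquiv w = WD.ofPerm t * w * (WD.ofPerm t)⁻¹ := rfl
  rw [h1, FDRep.char_conj, WD.minor_conj]
  have h2 : (WD.ofPerm t * w * (WD.ofPerm t)⁻¹).1.right = t * w.1.right * t⁻¹ := rfl
  rw [h2, Representation.char_conj]

theorem minorSum_congr (V : FDRep ℂ (WD n)) (μ : Ptn n) {S T : Finset (Fin n)}
    (h : S.card = T.card) : minorSum V μ S = minorSum V μ T := by
  obtain ⟨t, rfl⟩ := exists_perm_map_eq h
  rw [minorSum_map]

theorem minorSum_eq_sum_stab (V : FDRep ℂ (WD n)) (μ : Ptn n) (S : Finset (Fin n)) :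
    minorSum V μ S = ∑ w : WD.stab S,
      V.character w.1 * μ.rep.character w.1.1.right * (WB.minor S w.1.1 : ℂ) := by
  classical
  have h := Finset.sum_subtype (F := WD.instFintypeStab S) (Finset.univ.filter fun w => w ∈ WD.stab S) (p := (· ∈ WD.stab S))
    (fun w => by simp) fun w : WD n =>
      V.character w * μ.rep.character w.1.right * (WB.minor S w.1 : ℂ)
  refine Eq.trans ?_ (h.trans (Fintype.sum_congr _ _ fun _ => rfl))
  refine (Finset.sum_subset (Finset.filter_subset _ _) fun w _ hw => ?_).symm
  rw [WD.minor_of_notMem_stab fun hw' => hw (by simpa using hw')]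
  simp

/-- The representation `σ_μ` of the stabilizer of `S`, twisted by the minor on `S`. -/
def Ptn.repStab (μ : Ptn n) (S : Finset (Fin n)) : Representation ℂ (WD.stab S) μ.specht where
  toFun w := (WB.minor S w.1.1 : ℂ) • μ.rep w.1.1.right
  map_one' := by
    simp [WB.minor_one]
  map_mul' v w := by
    have h1 : (v * w).1.1.right = v.1.1.right * w.1.1.right := rfl
    have h2 : WB.minor S (v * w).1.1 = WB.minor S v.1.1 * WB.minor S w.1.1 := WD.minor_mul v.2
    rw [h1, h2, map_mul, smul_mul_smul_comm, Complex.ofReal_mul]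

/-- The representation of the stabilizer of `S` whose invariants are counted by `minorSum`. -/
def tensorStab (V : FDRep ℂ (WD n)) (μ : Ptn n) (S : Finset (Fin n)) :
    Representation ℂ (WD.stab S) (TensorProduct ℂ V μ.specht) :=
  Representation.tprod (MonoidHom.comp V.ρ (WD.stab S).subtype) (μ.repStab S)

theorem tensorStab_character (V : FDRep ℂ (WD n)) (μ : Ptn n) (S : Finset (Fin n))
    (w : WD.stab S) : (tensorStab V μ S).character w =
      V.character w.1 * μ.rep.character w.1.1.right * (WB.minor S w.1.1 : ℂ) := by
  rw [tensorStab, Representation.char_tensor, Pi.mul_apply, mul_assoc]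
  congr 1
  rw [Representation.character, Ptn.repStab, mul_comm]
  exact map_smul (LinearMap.trace ℂ μ.specht) _ _

theorem minorSum_eq_sum_character (V : FDRep ℂ (WD n)) (μ : Ptn n) (S : Finset (Fin n)) :
    minorSum V μ S = ∑ w, (tensorStab V μ S).character w := by
  rw [minorSum_eq_sum_stab]
  exact Finset.sum_congr rfl fun w _ => (tensorStab_character V μ S w).symm

theorem exists_nat_minorSum (V : FDRep ℂ (WD n)) (μ : Ptn n) (S : Finset (Fin n)) :
    ∃ m : ℕ, minorSum V μ S = Nat.card (WD.stab S) * m := by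
  rw [minorSum_eq_sum_character]
  exact (tensorStab V μ S).exists_nat_sum_character

/-- For self-transposed `μ` the character equals its sign twist, which cancels the sign relating
complementary minors. -/
theorem minorSum_compl (V : FDRep ℂ (WD n)) {μ : Ptn n} (hμ : μ = μ.transpose)
    (S : Finset (Fin n)) : minorSum V μ Sᶜ = minorSum V μ S := by
  refine Finset.sum_congr rfl fun w _ => ?_
  have h1 := μ.character_transpose w.1.right
  rw [← hμ] at h1
  by_cases hw : w ∈ WD.stab S
  · rw [WD.minor_compl hw]
    nth_rewrite 2 [h1]
    push_cast
    ring
  · have hw' : w ∉ WD.stab Sᶜ := fun h => hw fun i => by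
      have := h i
      simp only [Finset.mem_compl] at this
      tauto
    rw [WD.minor_of_notMem_stab hw, WD.minor_of_notMem_stab hw']

end Integrality

/-! ### Parity of the elliptic pairing -/

noncomputable section Parity

variable {n : ℕ}

theorem Equiv.Perm.sign_mul_self_cast (g : Equiv.Perm (Fin n)) :
    (((Equiv.Perm.sign g : ℤˣ) : ℤ) : ℂ) * (((Equiv.Perm.sign g : ℤˣ) : ℤ) : ℂ) = 1 := by
  rw [← Int.cast_mul, ← Units.val_mul, Int.units_mul_self]
  simp

/-- The symmetry of the invariants is the action of `s` on `V` tensored with `A * μ.rep s`, where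
`A` intertwines σ_μ with its sign twist. Conjugation by `s` turns the minor on `S` into the
complementary one, and `A` absorbs the resulting sign. The traces vanish because `s` times an
element of the stabilizer still exchanges `S` with its complement. -/
theorem exists_nat_minorSum_even (V : FDRep ℂ (WD n)) {μ : Ptn n} (hμ : μ = μ.transpose)
    (hn : 0 < n) (S : Finset (Fin n)) (s : Equiv.Perm (Fin n)) (hs : s * s = 1)
    (hsS : ∀ i, s i ∈ S ↔ i ∉ S) :
    ∃ m : ℕ, minorSum V μ S = Nat.card (WD.stab S) * (2 * m) := by
  have : Nonempty (Fin n) := ⟨⟨0, hn⟩⟩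
  obtain ⟨A, c, hc, hA, hAg⟩ := Ptn.exists_signTwist_self hμ
  have hss : ∀ i, s (s i) = i := fun i => by
    rw [← Equiv.Perm.mul_apply, hs, Equiv.Perm.one_apply]
  have hinv : (WD.ofPerm s)⁻¹ = WD.ofPerm s := by
    rw [inv_eq_iff_mul_eq_one, ← WD.ofPerm_mul, hs, WD.ofPerm_one]
  have hmap : Sᶜ.map s.toEmbedding = S := by
    ext i
    simp only [Finset.mem_map, Finset.mem_compl, Equiv.coe_toEmbedding]
    constructor
    · rintro ⟨j, hj, rfl⟩
      exact (hsS j).2 hj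
    · intro hi
      refine ⟨s i, fun h => (hsS i).1 h hi, hss i⟩
  have hconj : ∀ w ∈ WD.stab S, WD.ofPerm s * w * WD.ofPerm s ∈ WD.stab S := by
    intro w hw i
    change s (w.1.right (s i)) ∈ S ↔ i ∈ S
    rw [hsS, hw, hsS, not_not]
  have hinvol : Function.Involutive fun w : WD.stab S =>
      (⟨WD.ofPerm s * w.1 * WD.ofPerm s, hconj w.1 w.2⟩ : WD.stab S) := by
    intro w
    apply Subtype.ext
    have h1 : WD.ofPerm s * WD.ofPerm s = 1 := by rw [← WD.ofPerm_mul, hs, WD.ofPerm_one]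
    change WD.ofPerm s * (WD.ofPerm s * w.1 * WD.ofPerm s) * WD.ofPerm s = w.1
    rw [← mul_assoc, ← mul_assoc, h1, one_mul, mul_assoc, h1, mul_one]
  have hminor : ∀ w ∈ WD.stab S, WB.minor S (WD.ofPerm s * w * WD.ofPerm s).1 =
      ((Equiv.Perm.sign w.1.right : ℤ) : ℝ) * WB.minor S w.1 := by
    intro w hw
    have h1 := WD.minor_conj Sᶜ s w
    rw [hmap, hinv, WD.minor_compl hw] at h1
    exact h1
  set B : μ.specht →ₗ[ℂ] μ.specht := A * μ.rep s with hB
  have hBB : B * B = (((Equiv.Perm.sign s : ℤˣ) : ℤ) * c : ℂ) • 1 := by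
    rw [hB]
    nth_rewrite 1 [hAg]
    rw [smul_mul_assoc, mul_assoc, ← mul_assoc A, hA, smul_mul_assoc, one_mul, mul_smul_comm,
      ← map_mul, hs, map_one, smul_smul]
  have htrA : ∀ u : Equiv.Perm (Fin n), (∀ i, u i ∈ S ↔ i ∉ S) →
      LinearMap.trace ℂ _ (A * μ.rep u) = 0 := by
    intro u hu
    -- Conjugating `A * μ.rep u` by an odd `v` that commutes with `u` changes its sign, so its trace
    -- is zero.
    obtain ⟨v, hvu, hv⟩ := u.exists_commute_sign_neg S hu
    have h1 : A * μ.rep u = (A * μ.rep v) * (μ.rep u * μ.rep v⁻¹) := by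
      rw [mul_assoc, ← map_mul, ← map_mul, ← mul_assoc, hvu.eq, mul_inv_cancel_right]
    have h2 : LinearMap.trace ℂ _ (A * μ.rep u) = -LinearMap.trace ℂ _ (A * μ.rep u) := by
      nth_rewrite 1 [h1]
      rw [hAg, hv, LinearMap.trace_mul_comm, mul_smul_comm, mul_assoc, ← mul_assoc (μ.rep v⁻¹),
        ← map_mul, inv_mul_cancel, map_one, one_mul, LinearMap.trace_mul_comm]
      simp
    exact self_eq_neg.1 h2
  rw [minorSum_eq_sum_character]
  refine Representation.exists_nat_sum_character_even (tensorStab V μ S)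
    (TensorProduct.map (V.ρ (WD.ofPerm s)) B) (((Equiv.Perm.sign s : ℤˣ) : ℤ) * c)
    (mul_ne_zero (left_ne_zero_of_mul_eq_one (Equiv.Perm.sign_mul_self_cast s)) hc) ?_
    hinvol.toPerm ?_ ?_
  · rw [← TensorProduct.map_mul, hBB, ← map_mul, ← WD.ofPerm_mul, hs, WD.ofPerm_one, map_one,
      TensorProduct.map_smul_right, TensorProduct.map_one]
  · intro w
    change TensorProduct.map (V.ρ (WD.ofPerm s)) B *
        TensorProduct.map (V.ρ w.1) ((WB.minor S w.1.1 : ℂ) • μ.rep w.1.1.right) =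
      TensorProduct.map (V.ρ (WD.ofPerm s * w.1 * WD.ofPerm s))
        ((WB.minor S (WD.ofPerm s * w.1 * WD.ofPerm s).1 : ℂ) • μ.rep (s * w.1.1.right * s)) *
        TensorProduct.map (V.ρ (WD.ofPerm s)) B
    rw [← TensorProduct.map_mul, ← TensorProduct.map_mul, ← map_mul, ← map_mul,
      mul_assoc _ (WD.ofPerm s) (WD.ofPerm s), ← WD.ofPerm_mul, hs, WD.ofPerm_one, mul_one,
      hminor _ w.2]
    congr 1
    have h1 : μ.rep (s * w.1.1.right * s) * A =
        (((Equiv.Perm.sign w.1.1.right : ℤˣ) : ℤ) : ℂ) • (A * μ.rep (s * w.1.1.right * s)) := by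
      have h2 : Equiv.Perm.sign (s * w.1.1.right * s) = Equiv.Perm.sign w.1.1.right := by
        rw [map_mul, map_mul, mul_right_comm, ← map_mul, hs, map_one, one_mul]
      rw [hAg, h2, smul_smul, Equiv.Perm.sign_mul_self_cast, one_smul]
    rw [hB, smul_mul_assoc, ← mul_assoc (μ.rep (s * w.1.1.right * s)), h1, smul_mul_assoc,
      mul_smul_comm, smul_smul, mul_assoc, ← map_mul, mul_assoc A, ← map_mul,
      mul_assoc _ s s, hs, mul_one, Complex.ofReal_mul, mul_right_comm, Complex.ofReal_intCast,
      Equiv.Perm.sign_mul_self_cast, one_mul]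
  · intro w
    change LinearMap.trace ℂ _ (TensorProduct.map (V.ρ (WD.ofPerm s)) B *
        TensorProduct.map (V.ρ w.1) ((WB.minor S w.1.1 : ℂ) • μ.rep w.1.1.right)) = 0
    rw [← TensorProduct.map_mul, LinearMap.trace_tensorProduct', mul_smul_comm, map_smul, hB,
      mul_assoc, ← map_mul μ.rep, htrA, smul_zero, mul_zero]
    intro i
    rw [Equiv.Perm.mul_apply, hsS, w.2]

/-- The first `k` indices. -/
def initialSet (n k : ℕ) : Finset (Fin n) := Finset.univ.filter fun i => i.val < k

theorem card_initialSet {k : ℕ} (hk : k ≤ n) : (initialSet n k).card = k := by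
  rw [initialSet, Fin.card_filter_val_lt, min_eq_right hk]

/-- All subsets of size `k` contribute equally, and their number is the index of the stabilizer.
Each term becomes an average over a stabilizer, hence a dimension of invariants. -/
theorem ellipticPairing_repD (V : FDRep ℂ (WD n)) (μ : Ptn n) :
    ellipticPairing (reflD n) (RepGroup.mk V) (RepGroup.mk μ.repD) =
      ∑ k ∈ Finset.range (n + 1), (-1) ^ k *
        ((Nat.card (WD.stab (initialSet n k)) : ℂ)⁻¹ * minorSum V μ (initialSet n k)) := by
  have h1 : ∀ w : WD n, ((LinearMap.det (1 - reflD n w) : ℝ) : ℂ) =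
      ∑ k ∈ Finset.range (n + 1), (-1) ^ k *
        ∑ S ∈ Finset.univ.powersetCard k, (WB.minor S w.1 : ℂ) := by
    intro w
    rw [WB.det_one_sub_reflD, WB.det_one_sub_eq_sum_minor]
    push_cast
    rfl
  have h2 : ∑ w : WD n, V.character w * μ.repD.character w *
      ((LinearMap.det (1 - reflD n w) : ℝ) : ℂ) =
      ∑ k ∈ Finset.range (n + 1), (-1) ^ k *
        ∑ S ∈ Finset.univ.powersetCard k, minorSum V μ S := by
    simp only [h1, minorSum, Finset.mul_sum]
    rw [Finset.sum_comm]
    refine Finset.sum_congr rfl fun k _ => ?_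
    rw [Finset.sum_comm]
    refine Finset.sum_congr rfl fun S _ => Finset.sum_congr rfl fun w _ => ?_
    rw [Ptn.character_repD]
    ring
  rw [ellipticPairing_mk, h2, Finset.mul_sum]
  refine Finset.sum_congr rfl fun k hk => ?_
  have hk' : k ≤ n := Nat.lt_succ_iff.1 (Finset.mem_range.1 hk)
  have h3 : ∀ S ∈ Finset.univ.powersetCard k, minorSum V μ S =
      minorSum V μ (initialSet n k) := by
    intro S hS
    refine minorSum_congr V μ ?_
    rw [(Finset.mem_powersetCard.1 hS).2, card_initialSet hk']
  have h4 := WD.card_stab_mul_choose (initialSet n k)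
  rw [card_initialSet hk'] at h4
  rw [Finset.sum_congr rfl h3, Finset.sum_const, Finset.card_powersetCard, Finset.card_univ,
    Fintype.card_fin, ← Nat.card_eq_fintype_card, ← h4, nsmul_eq_mul]
  have h5 : (n.choose k : ℂ) ≠ 0 := Nat.cast_ne_zero.2 (Nat.choose_pos hk').ne'
  have h6 : (Nat.card (WD.stab (initialSet n k)) : ℂ) ≠ 0 := Nat.cast_ne_zero.2 Nat.card_pos.ne'
  push_cast
  field_simp

/-- The elliptic pairing with `μ × ∅` is integral. -/
theorem exists_int_ellipticPairing (V : FDRep ℂ (WD n)) (μ : Ptn n) :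
    ∃ m : ℤ, ellipticPairing (reflD n) (RepGroup.mk V) (RepGroup.mk μ.repD) = m := by
  choose m hm using exists_nat_minorSum V μ
  refine ⟨∑ k ∈ Finset.range (n + 1), (-1) ^ k * (m (initialSet n k) : ℤ), ?_⟩
  rw [ellipticPairing_repD]
  push_cast
  refine Finset.sum_congr rfl fun k _ => ?_
  rw [hm, inv_mul_cancel_left₀]
  exact Nat.cast_ne_zero.2 Nat.card_pos.ne'

/-- The terms at `k` and `2 * m - k` carry the same sign and pair up, so only the middle term needs
a parity hypothesis. -/
theorem exists_int_sum_alternating {m : ℕ} (f : ℕ → ℂ) (hf : ∀ k, ∃ a : ℤ, f k = a)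
    (hsymm : ∀ k ≤ 2 * m, f (2 * m - k) = f k) (hmid : ∃ a : ℤ, f m = 2 * a) :
    ∃ a : ℤ, ∑ k ∈ Finset.range (2 * m + 1), (-1) ^ k * f k = 2 * a := by
  choose g hg using hf
  obtain ⟨a, ha⟩ := hmid
  have h1 : ∑ k ∈ Finset.range (2 * m + 1), (-1) ^ k * f k =
      ∑ k ∈ Finset.range m, (-1) ^ k * f k + (-1) ^ m * f m +
        ∑ k ∈ Finset.range m, (-1) ^ k * f k := by
    rw [show 2 * m + 1 = (m + 1) + m by ring, Finset.sum_range_add, Finset.sum_range_succ]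
    congr 1
    rw [← Finset.sum_range_reflect]
    refine Finset.sum_congr rfl fun k hk => ?_
    have hk' := Finset.mem_range.1 hk
    have h2 : m + 1 + (m - 1 - k) = 2 * m - k := by omega
    rw [h2, hsymm k (by omega)]
    congr 1
    have h3 : Even (2 * m - k) ↔ Even k := by
      rw [Nat.even_sub (by omega)]
      simp
    rcases Nat.even_or_odd k with hk2 | hk2
    · rw [hk2.neg_one_pow, (h3.2 hk2).neg_one_pow]
    · rw [hk2.neg_one_pow, Odd.neg_one_pow]
      rw [← Nat.not_even_iff_odd] at hk2 ⊢
      exact fun h => hk2 (h3.1 h)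
  refine ⟨∑ k ∈ Finset.range m, (-1) ^ k * g k + (-1) ^ m * a, ?_⟩
  rw [h1, ha]
  push_cast
  simp only [hg]
  ring

/-- The elliptic pairing with `μ × ∅` is even if `n` is even and `μ` is its own transpose. -/
theorem exists_int_ellipticPairing_even (hn : 0 < n) (he : Even n) (V : FDRep ℂ (WD n))
    {μ : Ptn n} (hμ : μ = μ.transpose) :
    ∃ m : ℤ, ellipticPairing (reflD n) (RepGroup.mk V) (RepGroup.mk μ.repD) = 2 * m := by
  obtain ⟨m, hm⟩ := even_iff_exists_two_mul.1 he
  rw [ellipticPairing_repD]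
  subst hm
  have hcard : ∀ S : Finset (Fin (2 * m)), (Nat.card (WD.stab S) : ℂ) ≠ 0 := fun S =>
    Nat.cast_ne_zero.2 Nat.card_pos.ne'
  refine exists_int_sum_alternating _ ?_ ?_ ?_
  · intro k
    obtain ⟨a, ha⟩ := exists_nat_minorSum V μ (initialSet (2 * m) k)
    exact ⟨a, by rw [ha, inv_mul_cancel_left₀ (hcard _)]; simp⟩
  · intro k hk
    have h1 : (initialSet (2 * m) (2 * m - k)).card = (initialSet (2 * m) k)ᶜ.card := by
      rw [Finset.card_compl, card_initialSet hk, card_initialSet (Nat.sub_le _ _), Fintype.card_fin]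
    have h2 : Nat.card (WD.stab (initialSet (2 * m) (2 * m - k))) =
        Nat.card (WD.stab (initialSet (2 * m) k)) := by
      have h3 := WD.card_stab_mul_choose (initialSet (2 * m) (2 * m - k))
      rw [← WD.card_stab_mul_choose (initialSet (2 * m) k), card_initialSet (Nat.sub_le _ _),
        card_initialSet hk, Nat.choose_symm hk] at h3
      exact Nat.eq_of_mul_eq_mul_right (Nat.choose_pos hk) h3
    rw [h2, minorSum_congr V μ h1, minorSum_compl V hμ]
  -- Reversal is an involution exchanging the first `m` indices with the last `m`.
  · obtain ⟨a, ha⟩ := exists_nat_minorSum_even V hμ hn (initialSet (2 * m) m) Fin.revPerm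
      (by ext i; simp) (fun i => by simp [initialSet, Fin.val_rev]; omega)
    exact ⟨a, by rw [ha, inv_mul_cancel_left₀ (hcard _)]; simp⟩

end Parity

/-! ### Elliptic elements of `W(D_n)` over the same permutation are conjugate -/

noncomputable section EllipticConj

variable {n : ℕ}

/-- The product of the signs along the cycle of `i`. -/
def cycleSign (e : Fin n → ℤˣ) (p : Equiv.Perm (Fin n)) (i : Fin n) : ℤˣ :=
  ∏ t ∈ Finset.range (Function.minimalPeriod p i), e ((p ^ (t + 1)) i)

theorem minimalPeriod_perm_pos (p : Equiv.Perm (Fin n)) (i : Fin n) :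
    0 < Function.minimalPeriod p i :=
  Function.minimalPeriod_pos_of_mem_periodicPts
    (Function.mk_mem_periodicPts (orderOf_pos p) (by
      rw [Function.IsPeriodicPt, Equiv.Perm.iterate_eq_pow, pow_orderOf_eq_one]
      rfl))

theorem pow_minimalPeriod_perm (p : Equiv.Perm (Fin n)) (i : Fin n) :
    (p ^ Function.minimalPeriod p i) i = i := by
  rw [← Equiv.Perm.iterate_eq_pow]
  exact Function.iterate_minimalPeriod

/-- If the signs along a cycle multiply to `1`, there is a fixed vector supported on it. -/
theorem exists_fixed_of_cycleSign_eq_one {e : Fin n → ℤˣ} {p : Equiv.Perm (Fin n)} {i : Fin n}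
    (h : cycleSign e p i = 1) :
    ∃ v : Fin n → ℝ, v i = 1 ∧ ∀ j, ((e j : ℤ) : ℝ) * v (p⁻¹ j) = v j := by
  set l := Function.minimalPeriod p i with hl
  have hlpos : 0 < l := minimalPeriod_perm_pos p i
  -- `b k` is the basis vector at `i` transported `k` times by the signed permutation. Their sum
  -- over a period is fixed exactly because the total sign brings `b l` back to `b 0`.
  let s : ℕ → ℝ := fun k => ((∏ t ∈ Finset.range k, e ((p ^ (t + 1)) i) : ℤˣ) : ℤ)
  let b : ℕ → Fin n → ℝ := fun k => Pi.single ((p ^ k) i) (s k)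
  have hb : ∀ k j, ((e j : ℤ) : ℝ) * b k (p⁻¹ j) = b (k + 1) j := by
    intro k j
    simp only [b, Pi.single_apply]
    have h1 : p⁻¹ j = (p ^ k) i ↔ j = (p ^ (k + 1)) i := by
      rw [pow_succ', Equiv.Perm.mul_apply, Equiv.Perm.inv_eq_iff_eq]
    by_cases h2 : j = (p ^ (k + 1)) i
    · rw [if_pos (h1.2 h2), if_pos h2]
      simp only [s]
      rw [Finset.prod_range_succ, ← h2]
      push_cast
      ring
    · rw [if_neg (fun h3 => h2 (h1.1 h3)), if_neg h2, mul_zero]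
  have hb0 : b 0 = b l := by
    have h1 : s l = 1 := by
      change (((cycleSign e p i : ℤˣ) : ℤ) : ℝ) = 1
      rw [h]; simp
    simp only [b]
    rw [h1, pow_minimalPeriod_perm]
    simp [s]
  refine ⟨fun j => ∑ k ∈ Finset.range l, b k j, ?_, fun j => ?_⟩
  · change ∑ k ∈ Finset.range l, b k i = 1
    rw [Finset.sum_eq_single_of_mem 0 (Finset.mem_range.2 hlpos)]
    · change (Pi.single i (s 0) : Fin n → ℝ) i = 1
      simp [s]
    · intro k hk hk0
      simp only [b]
      rw [Pi.single_eq_of_ne]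
      intro h1
      refine Function.not_isPeriodicPt_of_pos_of_lt_minimalPeriod hk0 (Finset.mem_range.1 hk) ?_
      rw [Function.IsPeriodicPt, Equiv.Perm.iterate_eq_pow]
      exact h1.symm
  · simp only [Finset.mul_sum, hb]
    have h1 := Finset.sum_range_succ (fun k => b k j) l
    rw [Finset.sum_range_succ'] at h1
    rw [← hb0] at h1
    exact add_right_cancel h1

theorem WB.cycleSign_of_elliptic {w : WB n} (hw : (1 - WB.mat w).det ≠ 0) (i : Fin n) :
    cycleSign w.left w.right i = -1 := by
  rcases Int.units_eq_one_or (cycleSign w.left w.right i) with h | h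
  · exfalso
    obtain ⟨v, hvi, hv⟩ := exists_fixed_of_cycleSign_eq_one h
    refine hw (Matrix.exists_mulVec_eq_zero_iff.1 ⟨v, ?_, ?_⟩)
    · rintro rfl
      simp at hvi
    · rw [Matrix.sub_mulVec, Matrix.one_mulVec, sub_eq_zero]
      funext j
      rw [← hv j]
      simp [Matrix.mulVec, dotProduct, WB.mat]
  · exact h

theorem cycleSign_mul (e f : Fin n → ℤˣ) (p : Equiv.Perm (Fin n)) (i : Fin n) :
    cycleSign (e * f) p i = cycleSign e p i * cycleSign f p i := by
  simp [cycleSign, Finset.prod_mul_distrib]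

theorem sameCycle_inv_right {p : Equiv.Perm (Fin n)} {i j : Fin n} :
    p.SameCycle i (p⁻¹ j) ↔ p.SameCycle i j := by
  rw [← Equiv.Perm.sameCycle_apply_right]
  simp

/-- Each cycle carries a fixed vector that vanishes nowhere on it. The signs of its entries give
`d`, once a representative `r j` is chosen on every cycle. -/
theorem exists_coboundary {e : Fin n → ℤˣ} {p : Equiv.Perm (Fin n)}
    (h : ∀ i, cycleSign e p i = 1) : ∃ d : Fin n → ℤˣ, ∀ j, d j = e j * d (p⁻¹ j) := by
  choose v hvi hv using fun i => exists_fixed_of_cycleSign_eq_one (h i)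
  let r : Fin n → Fin n := fun j =>
    (Quotient.mk (Equiv.Perm.SameCycle.setoid p) j).out
  have hr : ∀ j, p.SameCycle (r j) j := fun j =>
    Quotient.exact (Quotient.out_eq (Quotient.mk (Equiv.Perm.SameCycle.setoid p) j))
  have hr' : ∀ j, r (p⁻¹ j) = r j := fun j => by
    have : Quotient.mk (Equiv.Perm.SameCycle.setoid p) (p⁻¹ j) =
        Quotient.mk (Equiv.Perm.SameCycle.setoid p) j :=
      Quotient.sound (sameCycle_inv_right.2 Equiv.Perm.SameCycle.rfl).symm
    simp only [r, this]
  have hne : ∀ i (k : ℕ), v i ((p ^ k) i) ≠ 0 := by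
    intro i k
    induction k with
    | zero => simp [hvi]
    | succ k ih =>
      rw [← hv i, pow_succ', Equiv.Perm.mul_apply]
      refine mul_ne_zero (by simp) ?_
      simpa using ih
  have hne' : ∀ j, v (r j) j ≠ 0 := fun j => by
    obtain ⟨k, hk⟩ := (hr j).exists_nat_pow_eq
    have := hne (r j) k
    rwa [hk] at this
  refine ⟨fun j => if 0 < v (r j) j then 1 else -1, fun j => ?_⟩
  have h1 := hv (r j) j
  have h2 := hne' (p⁻¹ j)
  rw [hr'] at h2
  simp only [hr']
  rcases Int.units_eq_one_or (e j) with h3 | h3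
  · rw [h3] at h1 ⊢
    simp only [Units.val_one, Int.cast_one, one_mul] at h1 ⊢
    rw [h1]
  · rw [h3] at h1 ⊢
    simp only [Units.val_neg, Units.val_one, Int.cast_neg, Int.cast_one, neg_mul, one_mul] at h1 ⊢
    rw [← h1]
    rcases lt_or_gt_of_ne h2 with h4 | h4
    · rw [if_pos (by linarith), if_neg (by linarith), neg_neg]
    · rw [if_neg (by linarith), if_pos h4]

theorem cycleSign_eq_prod (e : Fin n → ℤˣ) (p : Equiv.Perm (Fin n)) (i : Fin n) :
    cycleSign e p i = ∏ j with p.SameCycle i j, e j := by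
  rw [cycleSign]
  have hiter : ∀ k, (p ^ k) i = p^[k] i := fun k => by rw [Equiv.Perm.iterate_eq_pow]
  refine Finset.prod_bij (fun t _ => (p ^ (t + 1)) i) ?_ ?_ ?_ fun _ _ => rfl
  · intro t _
    refine Finset.mem_filter.2 ⟨Finset.mem_univ _, ⟨(t + 1 : ℕ), ?_⟩⟩
    rw [zpow_natCast]
  · intro t ht u hu h
    rw [pow_succ', pow_succ', Equiv.Perm.mul_apply, Equiv.Perm.mul_apply] at h
    have h' := p.injective h
    rw [hiter, hiter] at h'
    exact Function.iterate_injOn_Iio_minimalPeriod (Finset.mem_range.1 ht)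
      (Finset.mem_range.1 hu) h'
  · intro j hj
    have hij : p.SameCycle i (p⁻¹ j) :=
      sameCycle_inv_right.2 (Finset.mem_filter.1 hj).2
    obtain ⟨k, hk⟩ := hij.exists_nat_pow_eq
    refine ⟨k % Function.minimalPeriod p i,
      Finset.mem_range.2 (Nat.mod_lt _ (minimalPeriod_perm_pos p i)), ?_⟩
    rw [pow_succ', Equiv.Perm.mul_apply, hiter, Function.iterate_mod_minimalPeriod_eq, ← hiter, hk]
    simp

theorem WB.mul_left_apply (v w : WB n) (j : Fin n) :
    (v * w).left j = v.left j * w.left (v.right⁻¹ j) := rfl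

/-- The signed cycle of `w` through `i` commutes with `w`. -/
theorem WB.exists_commute_signProd (w : WB n) (i : Fin n) :
    ∃ c : WB n, c * w = w * c ∧ signProd n c = cycleSign w.left w.right i := by
  classical
  refine ⟨⟨fun j => if w.right.SameCycle i j then w.left j else 1, w.right.cycleOf i⟩, ?_, ?_⟩
  · refine SemidirectProduct.ext ?_ ?_
    · funext j
      rw [WB.mul_left_apply, WB.mul_left_apply]
      simp only [Equiv.Perm.cycleOf_inv, Equiv.Perm.cycleOf_apply,
        Equiv.Perm.sameCycle_inv, sameCycle_inv_right]
      split_ifs <;> simp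
    · refine Equiv.ext fun y => ?_
      simp only [SemidirectProduct.mul_right, Equiv.Perm.mul_apply, Equiv.Perm.cycleOf_apply,
        Equiv.Perm.sameCycle_apply_right]
      split_ifs <;> rfl
  · rw [cycleSign_eq_prod, Finset.prod_filter]
    rfl

/-- Elliptic elements of `W(D_n)` over the same permutation are conjugate in `W(D_n)`. -/
theorem WD.isConj_of_elliptic (hn : 0 < n) {v w : WD n} (hright : v.1.right = w.1.right)
    (hv : (1 - WB.mat v.1).det ≠ 0) (hw : (1 - WB.mat w.1).det ≠ 0) : IsConj v w := by
  -- Both elements have sign -1 on every cycle, so the quotient of their sign vectors is a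
  -- coboundary and a diagonal `D` conjugates one to the other in W(B_n).
  have h1 : ∀ i, cycleSign (v.1.left * w.1.left) v.1.right i = 1 := by
    intro i
    rw [cycleSign_mul, WB.cycleSign_of_elliptic hv]
    rw [hright, WB.cycleSign_of_elliptic hw]
    rfl
  obtain ⟨d, hd⟩ := exists_coboundary h1
  let D : WB n := ⟨d, 1⟩
  have hD : D * v.1 = w.1 * D := by
    refine SemidirectProduct.ext ?_ ?_
    · funext j
      rw [WB.mul_left_apply, WB.mul_left_apply]
      change d j * v.1.left j = w.1.left j * d (w.1.right⁻¹ j)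
      rw [hd j, hright, Pi.mul_apply, mul_right_comm, mul_right_comm (v.1.left j),
        Int.units_mul_self, one_mul]
    · change 1 * v.1.right = w.1.right * 1
      rw [one_mul, mul_one, hright]
  have key : ∀ c : WB n, c * v.1 = w.1 * c → signProd n c = 1 → IsConj v w := by
    intro c hc h
    refine isConj_iff.2 ⟨⟨c, h⟩, Subtype.ext ?_⟩
    change c * v.1 * c⁻¹ = w.1
    rw [hc, mul_inv_cancel_right]
  rcases Int.units_eq_one_or (signProd n D) with h | h
  · exact key D hD h
  -- If `D` has an odd number of minus signs, it is corrected by a signed cycle of `v`, which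
  -- centralizes `v` and has sign product -1. Choosing a cycle uses `0 < n`.
  · obtain ⟨c, hc, hc'⟩ := v.1.exists_commute_signProd ⟨0, hn⟩
    refine key (D * c) ?_ ?_
    · rw [mul_assoc, hc, ← mul_assoc, hD, mul_assoc]
    · rw [map_mul, h, hc', WB.cycleSign_of_elliptic hv]
      rfl

end EllipticConj

/-! ### The elliptic quotient of `W(D_n)` -/

noncomputable section EllipticQuotient

variable {n : ℕ}

theorem Ptn.ellipticPairing_repD_repD (hn : 0 < n) (μ ν : Ptn n) [Decidable (μ = ν)]
    [Decidable (μ.transpose = ν)] :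
    ellipticPairing (reflD n) (RepGroup.mk μ.repD) (RepGroup.mk ν.repD) =
      (if μ = ν then 1 else 0) + (-1) ^ n * (if μ.transpose = ν then 1 else 0) := by
  rw [ellipticPairing_mk, card_WD hn]
  simp only [Ptn.character_repD]
  rw [sum_WD_right_mul_det fun p => μ.rep.character p * ν.rep.character p,
    ← Ptn.sum_character_mul, ← Ptn.sum_character_mul, Nat.card_eq_fintype_card]
  simp only [Ptn.character_transpose, mul_add, mul_one, Finset.sum_add_distrib]
  have h1 : ∑ p : Equiv.Perm (Fin n), μ.rep.character p * ν.rep.character p *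
      ((-1) ^ n * (((Equiv.Perm.sign p : ℤˣ) : ℤ) : ℂ)) =
      (-1) ^ n * ∑ p : Equiv.Perm (Fin n), (((Equiv.Perm.sign p : ℤˣ) : ℤ) : ℂ) *
        μ.rep.character p * ν.rep.character p := by
    rw [Finset.mul_sum]
    exact Finset.sum_congr rfl fun p _ => by ring
  have h2 : (Fintype.card (Equiv.Perm (Fin n)) : ℂ) ≠ 0 := Nat.cast_ne_zero.2 Fintype.card_ne_zero
  rw [h1]
  field_simp

theorem WD.det_one_sub_conj (v w : WD n) :
    (1 - WB.mat (v * w * v⁻¹).1).det = (1 - WB.mat w.1).det := by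
  have h1 : WB.mat v.1 * WB.mat (v⁻¹).1 = 1 := by
    rw [← WB.mat_mul, ← Subgroup.coe_mul, mul_inv_cancel, Subgroup.coe_one, WB.mat_one]
  have h2 : 1 - WB.mat (v * w * v⁻¹).1 = WB.mat v.1 * (1 - WB.mat w.1) * WB.mat (v⁻¹).1 := by
    rw [Subgroup.coe_mul, Subgroup.coe_mul, WB.mat_mul, WB.mat_mul, mul_sub, sub_mul, mul_one, h1]
  rw [h2, Matrix.det_mul, Matrix.det_mul, mul_right_comm, ← Matrix.det_mul, h1, Matrix.det_one,
    one_mul]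

/-- By `WD.det_one_sub_mat`, the existence of an elliptic element over a permutation forces `(-1) ^
n` times its sign to be 1, so the total over the fibre is nonzero. -/
theorem sum_WD_det_of_right_eq {w : WD n} (hw : (1 - WB.mat w.1).det ≠ 0) :
    ∑ v : WD n, (if v.1.right = w.1.right then (1 : ℂ) else 0) *
      ((LinearMap.det (1 - reflD n v) : ℝ) : ℂ) = 2 ^ n := by
  have h1 : (-1) ^ n * ((Equiv.Perm.sign w.1.right : ℤ) : ℝ) = 1 := by
    have h := WD.det_one_sub_mat w
    exact (mul_eq_right₀ hw).1 h.symm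
  have h2 : (-1) ^ n * ((Equiv.Perm.sign w.1.right : ℤ) : ℂ) = 1 := by
    exact_mod_cast congrArg Complex.ofReal h1
  rw [sum_WD_right_mul_det fun p => if p = w.1.right then (1 : ℂ) else 0]
  simp only [ite_mul, one_mul, zero_mul, Finset.sum_ite_eq', Finset.mem_univ, if_true]
  rw [h2]
  ring

/-- A class function on `W(D_n)` orthogonal to all `μ × ∅` vanishes on elliptic elements. -/
theorem WD.eq_zero_of_orthogonal (hn : 0 < n) (φ : WD n → ℂ)
    (hφ : ∀ v w, φ (v * w * v⁻¹) = φ w)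
    (h : ∀ μ : Ptn n, ∑ w : WD n, φ w * μ.rep.character w.1.right *
      ((LinearMap.det (1 - reflD n w) : ℝ) : ℂ) = 0)
    {w : WD n} (hw : (1 - WB.mat w.1).det ≠ 0) : φ w = 0 := by
  -- The pushforward of `φ` times the determinant. It vanishes by completeness of the characters of
  -- S_n. On the fibre of `w`, however, `φ` is constant on elliptic elements, so the value there is
  -- `φ w` times `2 ^ n`.
  let f : Equiv.Perm (Fin n) → ℂ := fun p => ∑ v : WD n,
    if v.1.right = p then φ v * ((LinearMap.det (1 - reflD n v) : ℝ) : ℂ) else 0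
  have hf : f = 0 := by
    refine eq_zero_of_sum_mul_character_eq_zero f (fun p t => ?_) fun μ => ?_
    · refine (Fintype.sum_equiv (MulAut.conj (WD.ofPerm t)).toEquiv _ _ fun v => ?_).symm
      have h1 : (MulAut.conj (WD.ofPerm t)).toEquiv v = WD.ofPerm t * v * (WD.ofPerm t)⁻¹ := rfl
      have h2 : (WD.ofPerm t * v * (WD.ofPerm t)⁻¹).1.right = t * v.1.right * t⁻¹ := rfl
      rw [h1, h2, hφ, WB.det_one_sub_reflD, WB.det_one_sub_reflD, WD.det_one_sub_conj]
      simp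
    · rw [← h μ]
      simp only [f, Finset.sum_mul]
      rw [Finset.sum_comm]
      refine Finset.sum_congr rfl fun v _ => ?_
      simp only [ite_mul, zero_mul, Finset.sum_ite_eq, Finset.mem_univ, if_true]
      ring
  have h1 : f w.1.right = φ w * ∑ v : WD n, (if v.1.right = w.1.right then (1 : ℂ) else 0) *
      ((LinearMap.det (1 - reflD n v) : ℝ) : ℂ) := by
    rw [Finset.mul_sum]
    refine Finset.sum_congr rfl fun v _ => ?_
    split_ifs with hv
    · rw [WB.det_one_sub_reflD, one_mul]
      by_cases h0 : (1 - WB.mat v.1).det = 0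
      · rw [h0]; simp
      · obtain ⟨c, hc⟩ := isConj_iff.1 (WD.isConj_of_elliptic hn hv h0 hw)
        rw [← hc, hφ]
    · simp
  rw [hf, sum_WD_det_of_right_eq hw] at h1
  exact (mul_eq_zero.1 h1.symm).resolve_right (pow_ne_zero _ two_ne_zero)

theorem RepGroup.induction {G : Type} [Group G] {P : RepGroup G → Prop}
    (mk : ∀ V, P (RepGroup.mk V)) (neg : ∀ x, P x → P (-x)) (add : ∀ x y, P x → P y → P (x + y))
    (zero : P 0) (x : RepGroup G) : P x := by
  obtain ⟨y, rfl⟩ := QuotientAddGroup.mk_surjective x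
  induction y using FreeAbelianGroup.induction_on with
  | zero => exact zero
  | of V => exact mk V
  | neg V h => exact neg _ h
  | add y z hy hz => exact add _ _ hy hz

theorem RepGroup.character_conj {G : Type} [Group G] (x : RepGroup G) :
    ∀ v w : G, RepGroup.character G x (v * w * v⁻¹) = RepGroup.character G x w := by
  induction x using RepGroup.induction with
  | mk V => intro v w; rw [RepGroup.character_mk, FDRep.char_conj]
  | neg x h => intro v w; rw [map_neg, Pi.neg_apply, h, Pi.neg_apply]
  | add x y hx hy => intro v w; rw [map_add, Pi.add_apply, hx, hy, Pi.add_apply]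
  | zero => intro v w; rw [map_zero]; rfl

/-- The character of `x` vanishes on elliptic elements, and all other elements have determinant zero
in the pairing with any `y`. -/
theorem mem_ellipticRadical_of_orthogonal (hn : 0 < n) (x : RepGroup (WD n))
    (h : ∀ μ : Ptn n, ellipticPairing (reflD n) x (RepGroup.mk μ.repD) = 0) :
    x ∈ ellipticRadical (reflD n) := by
  have hdef : ∀ y, ellipticPairing (reflD n) x y = (Fintype.card (WD n) : ℂ)⁻¹ *
      ∑ w : WD n, RepGroup.character (WD n) x w * RepGroup.character (WD n) y w *
        ((LinearMap.det (1 - reflD n w) : ℝ) : ℂ) := fun y => rfl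
  have hcard : (Fintype.card (WD n) : ℂ)⁻¹ ≠ 0 :=
    inv_ne_zero (Nat.cast_ne_zero.2 Fintype.card_ne_zero)
  change ellipticPairing (reflD n) x = 0
  refine AddMonoidHom.ext fun y => ?_
  rw [hdef, AddMonoidHom.zero_apply]
  refine mul_eq_zero_of_right _ (Finset.sum_eq_zero fun w _ => ?_)
  rw [WB.det_one_sub_reflD]
  by_cases hw : (1 - WB.mat w.1).det = 0
  · rw [hw]; simp
  · rw [WD.eq_zero_of_orthogonal hn _ (RepGroup.character_conj x) (fun μ => ?_) hw, zero_mul,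
      zero_mul]
    have h1 := h μ
    rw [hdef, RepGroup.character_mk] at h1
    exact (mul_eq_zero.1 h1).resolve_left hcard

theorem pairing_classD (x : RepGroup (WD n)) (μ : Ptn n) :
    EllipticRepGroup.pairing (reflD n) (QuotientAddGroup.mk x) μ.classD =
      ellipticPairing (reflD n) x (RepGroup.mk μ.repD) := rfl

theorem Ptn.pairing_classD_classD (hn : 0 < n) (μ ν : Ptn n) [Decidable (μ = ν)]
    [Decidable (μ.transpose = ν)] :
    EllipticRepGroup.pairing (reflD n) μ.classD ν.classD =
      (if μ = ν then 1 else 0) + (-1) ^ n * (if μ.transpose = ν then 1 else 0) :=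
  Ptn.ellipticPairing_repD_repD hn μ ν

theorem RbarD.eq_zero_of_orthogonal (hn : 0 < n) (x : RbarD n)
    (h : ∀ μ : Ptn n, EllipticRepGroup.pairing (reflD n) x μ.classD = 0) : x = 0 := by
  obtain ⟨y, rfl⟩ := QuotientAddGroup.mk_surjective x
  exact (QuotientAddGroup.eq_zero_iff y).2 (mem_ellipticRadical_of_orthogonal hn y h)

theorem RbarD.exists_int_pairing (x : RbarD n) (μ : Ptn n) :
    ∃ m : ℤ, EllipticRepGroup.pairing (reflD n) x μ.classD = m := by
  obtain ⟨y, rfl⟩ := QuotientAddGroup.mk_surjective x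
  rw [pairing_classD]
  induction y using RepGroup.induction with
  | mk V => exact exists_int_ellipticPairing V μ
  | neg x h =>
    obtain ⟨a, ha⟩ := h
    exact ⟨-a, by rw [map_neg, AddMonoidHom.neg_apply, ha]; simp⟩
  | add x y hx hy =>
    obtain ⟨a, ha⟩ := hx
    obtain ⟨b, hb⟩ := hy
    exact ⟨a + b, by rw [map_add, AddMonoidHom.add_apply, ha, hb]; simp⟩
  | zero => exact ⟨0, by simp⟩

theorem RbarD.exists_int_pairing_even (hn : 0 < n) (he : Even n) (x : RbarD n) {μ : Ptn n}
    (hμ : μ = μ.transpose) :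
    ∃ m : ℤ, EllipticRepGroup.pairing (reflD n) x μ.classD = 2 * m := by
  obtain ⟨y, rfl⟩ := QuotientAddGroup.mk_surjective x
  rw [pairing_classD]
  induction y using RepGroup.induction with
  | mk V => exact exists_int_ellipticPairing_even hn he V hμ
  | neg x h =>
    obtain ⟨a, ha⟩ := h
    exact ⟨-a, by rw [map_neg, AddMonoidHom.neg_apply, ha]; simp⟩
  | add x y hx hy =>
    obtain ⟨a, ha⟩ := hx
    obtain ⟨b, hb⟩ := hy
    exact ⟨a + b, by rw [map_add, AddMonoidHom.add_apply, ha, hb]; push_cast; ring⟩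
  | zero => exact ⟨0, by simp⟩

/-- The class of the transposed partition is the class of the partition up to the sign `(-1)ⁿ`. -/
theorem RbarD.pairing_transpose (x : RbarD n) (μ : Ptn n) :
    EllipticRepGroup.pairing (reflD n) x μ.transpose.classD =
      (-1) ^ n * EllipticRepGroup.pairing (reflD n) x μ.classD := by
  obtain ⟨y, rfl⟩ := QuotientAddGroup.mk_surjective x
  have hdef : ∀ μ : Ptn n, EllipticRepGroup.pairing (reflD n) (QuotientAddGroup.mk y) μ.classD =
      (Fintype.card (WD n) : ℂ)⁻¹ *
      ∑ w : WD n, RepGroup.character (WD n) y w * RepGroup.character (WD n) (RepGroup.mk μ.repD) w *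
        ((LinearMap.det (1 - reflD n w) : ℝ) : ℂ) := fun μ => rfl
  rw [hdef, hdef, mul_left_comm]
  refine congrArg _ ?_
  rw [Finset.mul_sum]
  refine Finset.sum_congr rfl fun w _ => ?_
  rw [RepGroup.character_mk, RepGroup.character_mk, Ptn.character_repD, Ptn.character_repD,
    Ptn.character_transpose, WB.det_one_sub_reflD]
  have h1 := congrArg Complex.ofReal (WD.det_one_sub_mat w)
  push_cast at h1
  have h2 : ((-1 : ℂ) ^ n) * (-1) ^ n = 1 := by rw [← mul_pow]; simp
  have h3 := Equiv.Perm.sign_mul_self_cast w.1.right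
  conv_lhs => rw [h1]
  linear_combination (RepGroup.character (WD n) y w * μ.rep.character w.1.right *
    (((1 - WB.mat w.1).det : ℝ) : ℂ) * (-1) ^ n) * h3

/-- An orthogonal family with respect to which all expansion coefficients are integral, and which
detects zero, is a basis. -/
theorem exists_basis_of_orthogonal (hn : 0 < n) {ι : Type*} [Fintype ι] (κ : ι → Ptn n)
    (N : ι → ℤ) (hN : ∀ i, N i ≠ 0)
    (horth : ∀ i j, i ≠ j → EllipticRepGroup.pairing (reflD n) (κ i).classD (κ j).classD = 0)
    (hself : ∀ i, EllipticRepGroup.pairing (reflD n) (κ i).classD (κ i).classD = N i)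
    (hint : ∀ x i, ∃ m : ℤ, EllipticRepGroup.pairing (reflD n) x (κ i).classD = N i * m)
    (hdet : ∀ x, (∀ i, EllipticRepGroup.pairing (reflD n) x (κ i).classD = 0) →
      ∀ μ : Ptn n, EllipticRepGroup.pairing (reflD n) x μ.classD = 0) :
    ∃ b : Module.Basis ι ℤ (RbarD n), ∀ i, b i = (κ i).classD := by
  classical
  have hsum : ∀ (a : ι → ℤ) j, EllipticRepGroup.pairing (reflD n)
      (∑ i, a i • (κ i).classD) (κ j).classD = N j * a j := by
    intro a j
    rw [map_sum, AddMonoidHom.finsetSum_apply, Finset.sum_eq_single_of_mem j (Finset.mem_univ j)]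
    · rw [map_zsmul, AddMonoidHom.zsmul_apply, hself, zsmul_eq_mul, mul_comm]
    · intro i _ hij
      rw [map_zsmul, AddMonoidHom.zsmul_apply, horth i j hij, smul_zero]
  have hli : LinearIndependent ℤ fun i : ι => ((κ i).classD : RbarD n) := by
    rw [Fintype.linearIndependent_iff]
    intro a ha j
    have h1 := hsum a j
    rw [ha, map_zero, AddMonoidHom.zero_apply] at h1
    have h2 : N j * a j = 0 := by exact_mod_cast h1.symm
    exact (mul_eq_zero.1 h2).resolve_left (hN j)
  have hspan : ⊤ ≤ Submodule.span ℤ (Set.range fun i => (κ i).classD) := by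
    intro x _
    choose m hm using hint x
    -- By `hint` the expansion coefficients are integers, so the candidate lies in the span and has
    -- the same pairings as `x`.
    have h1 : x - ∑ i, m i • (κ i).classD = 0 := by
      refine RbarD.eq_zero_of_orthogonal hn _ (hdet _ fun j => ?_)
      rw [map_sub, AddMonoidHom.sub_apply, hsum, hm, sub_self]
    rw [sub_eq_zero.1 h1]
    exact Submodule.sum_mem _ fun i _ =>
      Submodule.smul_mem _ _ (Submodule.subset_span ⟨i, rfl⟩)
  exact ⟨Module.Basis.mk hli hspan, fun i => Module.Basis.mk_apply hli hspan i⟩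

end EllipticQuotient

/-! ### The basis for an arbitrary choice of representatives -/

noncomputable instance PtnClass.instFintype {n : ℕ} : Fintype (PtnClass n) := Fintype.ofFinite _

theorem Ptn.mk_transpose {n : ℕ} (μ : Ptn n) :
    Quotient.mk (Ptn.setoid n) μ.transpose = Quotient.mk (Ptn.setoid n) μ :=
  (Quotient.sound (Or.inr rfl : (Ptn.setoid n).r μ μ.transpose)).symm

/-- For every choice `s` of representatives of the partitions of `n` up to transposition, the
classes `[λ × ∅]` form an orthonormal (`n` odd, `λ` not self-transposed), resp. orthogonal
(`n` even), `ℤ`-basis of the elliptic quotient for `W(D_n)`. -/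
theorem lemmal (n : ℕ) (hn : 0 < n) (s : PtnClass n → Ptn n)
    (hs : ∀ c : PtnClass n, Quotient.mk (Ptn.setoid n) (s c) = c) :
    (Odd n →
      (∃ b : Module.Basis {c : PtnClass n // s c ≠ (s c).transpose} ℤ (RbarD n),
        ∀ c, b c = (s c.1).classD) ∧
      (∀ c d : {c : PtnClass n // s c ≠ (s c).transpose}, c ≠ d →
        EllipticRepGroup.pairing (reflD n) (s c.1).classD (s d.1).classD = 0) ∧
      (∀ c : {c : PtnClass n // s c ≠ (s c).transpose},
        EllipticRepGroup.pairing (reflD n) (s c.1).classD (s c.1).classD = 1)) ∧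
    (Even n →
      (∃ b : Module.Basis (PtnClass n) ℤ (RbarD n), ∀ c, b c = (s c).classD) ∧
      (∀ c d : PtnClass n, c ≠ d →
        EllipticRepGroup.pairing (reflD n) (s c).classD (s d).classD = 0) ∧
      (∀ c : PtnClass n,
        (s c ≠ (s c).transpose →
          EllipticRepGroup.pairing (reflD n) (s c).classD (s c).classD = 1) ∧
        (s c = (s c).transpose →
          EllipticRepGroup.pairing (reflD n) (s c).classD (s c).classD = 2))) := by
  classical
  have hne : ∀ c d, c ≠ d → s c ≠ s d := fun c d h h' => h (by rw [← hs c, h', hs d])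
  have hne' : ∀ c d, c ≠ d → (s c).transpose ≠ s d := fun c d h h' =>
    h (by rw [← hs c, ← Ptn.mk_transpose, h', hs d])
  have horth : ∀ c d, c ≠ d →
      EllipticRepGroup.pairing (reflD n) (s c).classD (s d).classD = 0 := fun c d h => by
    rw [Ptn.pairing_classD_classD hn, if_neg (hne c d h), if_neg (hne' c d h), mul_zero, add_zero]
  have hself : ∀ c, s c ≠ (s c).transpose →
      EllipticRepGroup.pairing (reflD n) (s c).classD (s c).classD = 1 := fun c h => by
    rw [Ptn.pairing_classD_classD hn, if_pos rfl, if_neg fun h' => h h'.symm, mul_zero, add_zero]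
  have hrep : ∀ μ : Ptn n, μ = s (Quotient.mk (Ptn.setoid n) μ) ∨ μ = (s (Quotient.mk (Ptn.setoid n) μ)).transpose :=
    fun μ => Quotient.exact (hs (Quotient.mk (Ptn.setoid n) μ))
  refine ⟨fun ho => ?_, fun he => ?_⟩
  · have horth' : ∀ c d : {c : PtnClass n // s c ≠ (s c).transpose}, c ≠ d →
        EllipticRepGroup.pairing (reflD n) (s c.1).classD (s d.1).classD = 0 := fun c d h =>
      horth c.1 d.1 fun h' => h (Subtype.ext h')
    refine ⟨?_, horth', fun c => hself c.1 c.2⟩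
    refine exists_basis_of_orthogonal hn
      (fun c : {c : PtnClass n // s c ≠ (s c).transpose} => s c.1) (fun _ => 1) ?_ ?_ ?_ ?_ ?_
    · exact fun _ => one_ne_zero
    · exact horth'
    · intro c
      rw [hself c.1 c.2, Int.cast_one]
    · intro x c
      obtain ⟨m, hm⟩ := RbarD.exists_int_pairing x (s c.1)
      exact ⟨m, by rw [hm, Int.cast_one, one_mul]⟩
    · intro x hx μ
      have h0 : EllipticRepGroup.pairing (reflD n) x (s (Quotient.mk (Ptn.setoid n) μ)).classD = 0 := by
        by_cases h : s (Quotient.mk (Ptn.setoid n) μ) = (s (Quotient.mk (Ptn.setoid n) μ)).transpose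
        -- For odd `n` a self-transposed partition pairs to its own negative, so it pairs to zero
        -- with everything and can be left out of the basis.
        · have h1 := RbarD.pairing_transpose x (s (Quotient.mk (Ptn.setoid n) μ))
          rw [← h, ho.neg_one_pow, neg_one_mul] at h1
          exact self_eq_neg.1 h1
        · exact hx ⟨Quotient.mk (Ptn.setoid n) μ, h⟩
      rcases hrep μ with h | h
      · exact (congrArg (fun ν : Ptn n => EllipticRepGroup.pairing (reflD n) x ν.classD) h).trans h0
      · refine (congrArg (fun ν : Ptn n => EllipticRepGroup.pairing (reflD n) x ν.classD) h).trans ?_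
        rw [RbarD.pairing_transpose, h0, mul_zero]
  · have hself' : ∀ c, s c = (s c).transpose →
        EllipticRepGroup.pairing (reflD n) (s c).classD (s c).classD = 2 := fun c h => by
      rw [Ptn.pairing_classD_classD hn, if_pos rfl, if_pos h.symm, he.neg_one_pow]
      norm_num
    refine ⟨?_, horth, fun c => ⟨hself c, hself' c⟩⟩
    -- The norm 2 of a self-transposed class is where the evenness of its pairings is needed for
    -- integral coefficients.
    refine exists_basis_of_orthogonal hn s (fun c => if s c = (s c).transpose then 2 else 1)
      (fun c => by split_ifs <;> norm_num) horth (fun c => ?_) (fun x c => ?_) fun x hx μ => ?_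
    · split_ifs with h
      · rw [hself' c h]; norm_num
      · rw [hself c h]; norm_num
    · split_ifs with h
      · obtain ⟨m, hm⟩ := RbarD.exists_int_pairing_even hn he x h
        exact ⟨m, by rw [hm]; norm_num⟩
      · obtain ⟨m, hm⟩ := RbarD.exists_int_pairing x (s c)
        exact ⟨m, by rw [hm]; norm_num⟩
    · rcases hrep μ with h | h
      · exact (congrArg (fun ν : Ptn n => EllipticRepGroup.pairing (reflD n) x ν.classD) h).trans
          (hx _)
      · refine (congrArg (fun ν : Ptn n => EllipticRepGroup.pairing (reflD n) x ν.classD) h).trans ?_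
        rw [RbarD.pairing_transpose, hx, mul_zero]
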